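/- Let $G=(V,E)$ be a finite directed acyclic network with unit-capacity edges (parallel edges allowed) and two unit-rate sources whose symbols $y_1,y_2$ are placed at nodes $s_1,s_2$ of $G$ (possibly $s_1=s_2$), and let $R_1,\dots,R_t$, $t\ge 1$, be receivers at distinct nodes, each having minimum cut $2$ from the pair of sources (that is, from an extra node joined by one unit-capacity edge to $s_1$ and one to $s_2$). Call this a configuration with two sources and $t$ receivers. A secure network code over $\mathbb F_q$ consists of - a (possibly randomized) encoder mapping an information symbol $S$, uniform on $\mathbb F_q$, to a pair $Y=(y_1,y_2)\in\mathbb F_q^2$ with $H(S\mid Y)=0$, and - a linear network code over $\mathbb F_q$ in which every edge $e$ carries a packet $Z_e=c_e\cdot Y$ that is a linear combination of the packets entering its tail and of the source symbols placed there, and from which every receiver can recover $Y$, such that $H(S\mid Z_e)=H(S)$ for every single edge $e$ (the wiretapper observes at most one edge). Put $$N(t)=\left\lfloor \sqrt{2t-\tfrac74}+\tfrac12\right\rfloor+1 .$$ **Sufficiency.** For every configuration with two sources and $t\ge1$ receivers and every finite field $\mathbb F_q$ with $q\ge N(t)$, there is a secure network code over $\mathbb F_q$. One may take for the encoder the coset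 code with parity check matrix $H=[1\ 1]$ ($Y$ is uniform on $\{y : y_1+y_2=S\}$), and coding vectors $c_e$ none of which is a nonzero multiple of $[1\ 1]$ (each nonzero coding vector represents a point of the projective line $PG(1,q)$ other than $[1\ 1]$). **Necessity.** For every $t\ge1$ there is a configuration with two sources and $t$ receivers such that every finite field $\mathbb F_q$ over which it has a secure network code satisfies $q\ge N(t)$. The configuration can be chosen without parallel edges, with both symbols at one source node $s$ and with minimum cut exactly $2$ between $s$ and each receiver. -/

import Mathlib

namespace WiretapNetwork

/-! ### Entropy of finite random variables -/

/-- Shannon entropy (in nats) of a probability mass function on a finite type. -/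
noncomputable def entropy {α : Type*} [Fintype α] (p : PMF α) : ℝ :=
  ∑ a, Real.negMulLog (p a).toReal

/-- Conditional Shannon entropy `H(X | Z) = H(X, Z) - H(Z)` of two finitely valued random
variables on the discrete probability space `(Ω, p)`. -/
noncomputable def condEntropy {Ω α β : Type*} [Fintype α] [Fintype β] (p : PMF Ω)
    (X : Ω → α) (Z : Ω → β) : ℝ :=
  entropy (p.map fun ω => (X ω, Z ω)) - entropy (p.map Z)

/-! ### Networks with two sources -/

/-- A directed acyclic multigraph with vertices `V` and unit capacity edges `E`, together with the
places of two unit rate sources (the places may coincide: then one source node has both symbols). -/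
structure Network (V E : Type*) where
  tail : E → V
  head : E → V
  source : Fin 2 → V
  acyclic : ∀ v, ¬ Relation.TransGen (fun u w => ∃ e, tail e = u ∧ head e = w) v v

namespace Network

variable {V E : Type*}

/-- The edges that leave a set of vertices. -/
def edgesOut (N : Network V E) (X : Set V) : Set E :=
  {e | N.tail e ∈ X ∧ N.head e ∉ X}

/-- The minimum cut between the pair of sources and the node `r`, that is, the minimum cut between
an extra node and `r` when the extra node is joined by a unit capacity edge to the place of
each of the two sources: a source outside `X` contributes such an edge to the cut. -/
noncomputable def minCut (N : Network V E) (r : V) : ℕ :=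
  sInf {c | ∃ X : Set V, r ∉ X ∧ c = (N.edgesOut X).ncard + {i | N.source i ∉ X}.ncard}

/-- The minimum cut between two nodes of the network. -/
noncomputable def minCutFrom (N : Network V E) (s r : V) : ℕ :=
  sInf {c | ∃ X : Set V, s ∈ X ∧ r ∉ X ∧ c = (N.edgesOut X).ncard}

/-- A multicast configuration with two sources: the `t` receivers are at distinct nodes, and the
minimum cut to each of them is two. -/
def IsConfiguration (N : Network V E) {t : ℕ} (R : Fin t → V) : Prop :=
  Function.Injective R ∧ ∀ j, N.minCut (R j) = 2

variable {F : Type*} [Field F]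

/-- The coding vectors of the symbols available at the node `v`, when edge `e` has the coding
vector `f e`: those of the edges into `v`, and the unit vectors of the sources placed at `v`. -/
def inputs (N : Network V E) (f : E → Fin 2 → F) (v : V) : Set (Fin 2 → F) :=
  {c | (∃ e, N.head e = v ∧ f e = c) ∨ ∃ i, N.source i = v ∧ Pi.single i 1 = c}

/-- `f` is the family of (global) coding vectors of a linear network code: each edge carries
a linear combination of the symbols available at its tail. When the source symbols are `y`, the
packet on the edge `e` is `f e ⬝ᵥ y`. -/
def IsLinearCode (N : Network V E) (f : E → Fin 2 → F) : Prop :=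
  ∀ e, f e ∈ Submodule.span F (N.inputs f (N.tail e))

/-- The node `r` can compute both source symbols from the symbols available to it. -/
def Decodes (N : Network V E) (f : E → Fin 2 → F) (r : V) : Prop :=
  ∀ y y' : Fin 2 → F, (∀ c ∈ N.inputs f r, c ⬝ᵥ y = c ⬝ᵥ y') → y = y'

end Network

/-! ### Wiretap codes -/

theorem exists_dotProduct_eq {F : Type*} [Field F] {H : Fin 2 → F} (hH : H ≠ 0) (s : F) : ∃ y, H ⬝ᵥ y = s := by
  obtain ⟨i, hi⟩ := Function.ne_iff.mp hH
  refine ⟨Pi.single i ((H i)⁻¹ * s), ?_⟩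
  have hi' : H i ≠ 0 := hi
  simp [hi']

theorem oneOne_ne_zero {F : Type*} [Field F] : (![1, 1] : Fin 2 → F) ≠ 0 := fun h => by
  simpa using congrFun h 0

variable {F : Type*} [Field F] [Fintype F]

/-- The joint law of the information symbol `S`, uniform on `F`, and of the two symbols `Y` that
the stochastic encoder `enc` produces from it. -/
noncomputable def jointLaw (enc : F → PMF (Fin 2 → F)) : PMF (F × (Fin 2 → F)) :=
  (PMF.uniformOfFintype F).bind fun s => (enc s).map (Prod.mk s)

open Classical in
/-- Coset coding with the `1 × 2` parity check matrix `H`: the transmitted word is uniform on the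
coset of the words of syndrome `s`. -/
noncomputable def cosetEncoder (H : Fin 2 → F) (hH : H ≠ 0) (s : F) : PMF (Fin 2 → F) :=
  PMF.uniformOfFinset {y | H ⬝ᵥ y = s}
    (by
      obtain ⟨y, hy⟩ := exists_dotProduct_eq hH s
      exact ⟨y, by simpa using hy⟩)

/-- The wiretap encoder `enc` and the linear network code `f` form a secure network code: the
network code multicasts the two encoded symbols `Y` to all receivers, `H(S | Y) = 0`, and
`H(S | Z) = H(S)` for the packet `Z` on any single edge. -/
structure IsSecureCode {V E : Type*} (N : Network V E) {t : ℕ} (R : Fin t → V)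
    (enc : F → PMF (Fin 2 → F)) (f : E → Fin 2 → F) : Prop where
  linear : N.IsLinearCode f
  decodes : ∀ j, N.Decodes f (R j)
  recovers : condEntropy (jointLaw enc) Prod.fst Prod.snd = 0
  secure : ∀ e, condEntropy (jointLaw enc) Prod.fst (fun ω => f e ⬝ᵥ ω.2) =
    entropy ((jointLaw enc).map Prod.fst)

/-- The alphabet size `⌊√(2t - 7/4) + 1/2⌋ + 1`. -/
noncomputable def alphabetSize (t : ℕ) : ℕ :=
  ⌊√(2 * (t : ℝ) - 7 / 4) + 1 / 2⌋₊ + 1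

end WiretapNetwork

/-! For `1 ≤ t`, `alphabetSize t` is the least `q` with `t ≤ q.choose 2`, so the theorem compares
the number of receivers with the number of pairs of colours, a colour being one of the `q` points of
the projective line other than the one kept from the wiretapper.

Sufficiency. Split the network into information flows, each starting at a source or at an edge whose
tail receives several flows, and give one coding vector to a whole flow. Choose two distinct flows
at each receiver and two distinct parents for each coding flow. It suffices to colour the flows so
that the sources differ, the two flows of each receiver differ, and a flow whose parents agree
copies them (`exists_coloring`). A flow may be merged with a parent unless that pair has itself to
be separated. When no merge is possible, the `n + 2` flows and at most `t + n` pairs form a graph of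
minimum degree at least 2. If it had no `q`-colouring, a subset of minimum internal degree at least
`q` would exist, and counting degrees would give `t > q.choose 2`. Coding vectors off the point `[1
1]` are secure because `c ⬝ᵥ y` is then independent of `y 0 + y 1`.

Necessity. For any encoder, if packets in all `q + 1` projective directions were each independent of
`S`, the joint law minus the product law would have zero sum on every line of the affine plane,
hence vanish. Then `S` would be independent of `Y`, against `H(S | Y) = 0`. So a secure code misses
a point (`IsSecureCode.exists_point`). In the chain network, with `alphabetSize t = n + 2`, the `n +
2` branches must carry distinct points, so `n + 3 ≤ q + 1`. The chain makes one receiver do the work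
of `n + 1`: separating branch `0` from the last branch separates it from all the others. -/

namespace WiretapNetwork

/-! ### Colouring information flows -/

section Coloring

open Finset

variable {D κ : Type*} [DecidableEq D] [Fintype κ]

/-- A finite graph, given by its adjacent ordered pairs, can be coloured unless it has a nonempty
set of vertices with as many neighbours in the set as there are colours. -/
theorem exists_coloring_or_exists_dense [Nonempty κ] (T : Finset (D × D))
    (hsymm : ∀ u v, (u, v) ∈ T → (v, u) ∈ T) (hirr : ∀ u, (u, u) ∉ T) (U : Finset D) :
    (∃ c : D → κ, ∀ u ∈ U, ∀ v ∈ U, (u, v) ∈ T → c u ≠ c v) ∨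
      ∃ W ⊆ U, W.Nonempty ∧ ∀ v ∈ W, Fintype.card κ ≤ #{u ∈ W | (v, u) ∈ T} := by
  classical
  induction U using Finset.strongInduction with
  | H U ih =>
    by_cases hU : U.Nonempty
    · by_cases hdense : ∀ v ∈ U, Fintype.card κ ≤ #{u ∈ U | (v, u) ∈ T}
      · exact Or.inr ⟨U, Subset.rfl, hU, hdense⟩
      push Not at hdense
      obtain ⟨w, hw, hlt⟩ := hdense
      -- Greedy step: `w` has fewer neighbours than there are colours, so a colouring of the rest
      -- extends to it.
      obtain ⟨c, hc⟩ | ⟨W, hWU, hW⟩ := ih (U.erase w) (erase_ssubset hw)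
      · left
        obtain ⟨k, hk⟩ : ∃ k, k ∉ ({u ∈ U | (w, u) ∈ T}).image c := by
          by_contra! h
          have : Fintype.card κ ≤ #(({u ∈ U | (w, u) ∈ T}).image c) := by
            rw [eq_univ_iff_forall.mpr h, card_univ]
          exact absurd (this.trans card_image_le) (not_le.mpr hlt)
        have hk' : ∀ u ∈ U, (w, u) ∈ T → c u ≠ k := fun u hu hT h =>
          hk (mem_image.mpr ⟨u, mem_filter.mpr ⟨hu, hT⟩, h⟩)
        refine ⟨Function.update c w k, fun u hu v hv huv => ?_⟩
        by_cases h1 : u = w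
        · subst h1
          have h2 : v ≠ u := fun h => hirr u (h ▸ huv)
          simpa [h2] using (hk' v hv huv).symm
        · by_cases h2 : v = w
          · subst h2
            simpa [h1] using hk' u hu (hsymm _ _ huv)
          · simpa [h1, h2] using hc u (mem_erase.mpr ⟨h1, hu⟩) v (mem_erase.mpr ⟨h2, hv⟩) huv
      · exact Or.inr ⟨W, hWU.trans (erase_subset _ _), hW⟩
    · left
      rw [not_nonempty_iff_eq_empty] at hU
      subst hU
      exact ⟨fun _ => Classical.arbitrary κ, by simp⟩

/-- Vertices of degree at least two and few edges: the graph can be coloured. -/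
theorem exists_coloring_of_card_le {t n : ℕ} (hκ : 2 ≤ Fintype.card κ)
    (ht : t ≤ (Fintype.card κ).choose 2) (T : Finset (D × D))
    (hsymm : ∀ u v, (u, v) ∈ T → (v, u) ∈ T) (hirr : ∀ u, (u, u) ∉ T) (U : Finset D)
    (hU : #U = n + 2) (hdeg : ∀ v ∈ U, 2 ≤ #{u ∈ U | (v, u) ∈ T}) (hT : #T ≤ 2 * (t + n)) :
    ∃ c : D → κ, ∀ u ∈ U, ∀ v ∈ U, (u, v) ∈ T → c u ≠ c v := by
  have : Nonempty κ := Fintype.card_pos_iff.mp (by omega)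
  obtain h | ⟨W, hWU, ⟨w, hw⟩, hW⟩ := exists_coloring_or_exists_dense (κ := κ) T hsymm hirr U
  · exact h
  exfalso
  set m := Fintype.card κ
  have hWcard : m + 1 ≤ #W := by
    have h1 : ({u ∈ W | (w, u) ∈ T}) ⊆ W.erase w := fun u hu => by
      obtain ⟨hu, huT⟩ := mem_filter.mp hu
      exact mem_erase.mpr ⟨fun h => hirr w (h ▸ huT), hu⟩
    have h2 := card_le_card h1
    rw [card_erase_of_mem hw] at h2
    have h3 := hW w hw
    have h4 : 0 < #W := card_pos.mpr ⟨w, hw⟩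
    omega
  have hsum : ∑ v ∈ U, #{u ∈ U | (v, u) ∈ T} ≤ #T := by
    rw [← card_sigma]
    refine card_le_card_of_injOn (fun z => (z.1, z.2)) (fun z hz => ?_) fun z _ z' _ h => ?_
    · simp only [coe_sigma, Set.mem_sigma_iff, mem_coe, mem_filter] at hz
      exact hz.2.2
    · rcases z with ⟨a, b⟩
      rcases z' with ⟨a', b'⟩
      simp only [Prod.mk.injEq] at h
      obtain ⟨rfl, rfl⟩ := h
      rfl
  have hlow : #W * m + #(U \ W) * 2 ≤ ∑ v ∈ U, #{u ∈ U | (v, u) ∈ T} := by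
    rw [← sum_sdiff hWU, add_comm]
    refine add_le_add ?_ ?_
    · simpa using card_nsmul_le_sum (U \ W) (fun v => #{u ∈ U | (v, u) ∈ T}) 2
        fun v hv => hdeg v (mem_sdiff.mp hv).1
    · simpa using card_nsmul_le_sum W (fun v => #{u ∈ U | (v, u) ∈ T}) m
        fun v hv => (hW v hv).trans (card_le_card (filter_subset_filter _ hWU))
  have hsd : #(U \ W) + #W = n + 2 := by rw [card_sdiff_add_card_eq_card hWU, hU]
  have hch : 2 * m.choose 2 = m * (m - 1) := by
    rw [Nat.choose_two_right, Nat.mul_div_cancel' (Nat.even_mul_pred_self m).two_dvd]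
  obtain ⟨k, hk⟩ : ∃ k, m = k + 2 := ⟨m - 2, by omega⟩
  rw [hk] at hch hlow hWcard ht
  simp only [show k + 2 - 1 = k + 1 by omega] at hch
  -- With `m = k + 2`, the degree count gives `#W * (m - 2) + 4 ≤ 2 * t ≤ m * (m - 1)`, while `#W ≥
  -- m + 1` makes the left side at least `m * (m - 1) + 2`.
  nlinarith [Nat.mul_le_mul_right k hWcard]

/-- Colouring the items of a two source network: `a` and `b` are the sources, and `A` consists of
the other items, with the parents `p d` and `q d`. -/
theorem exists_coloring {t : ℕ} (hκ : 2 ≤ Fintype.card κ)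
    (ht : t ≤ (Fintype.card κ).choose 2) {a b : D} (hab : a ≠ b) (rank : D → ℕ) (A : Finset D)
    (ha : a ∉ A) (hb : b ∉ A) (p q : D → D) (x y : Fin t → D)
    (hpq : ∀ d ∈ A, p d ≠ q d) (hp : ∀ d ∈ A, p d ∈ insert a (insert b A))
    (hq : ∀ d ∈ A, q d ∈ insert a (insert b A)) (hrp : ∀ d ∈ A, rank (p d) < rank d)
    (hrq : ∀ d ∈ A, rank (q d) < rank d) (hxy : ∀ j, x j ≠ y j)
    (hx : ∀ j, x j ∈ insert a (insert b A)) (hy : ∀ j, y j ∈ insert a (insert b A)) :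
    ∃ c : D → κ, c a ≠ c b ∧ (∀ j, c (x j) ≠ c (y j)) ∧
      ∀ d ∈ A, c (p d) = c (q d) → c d = c (p d) := by
  classical
  induction hn : #A generalizing A p q x y with
  | zero =>
    rw [card_eq_zero] at hn
    subst hn
    obtain ⟨k, l, hkl⟩ := Fintype.exists_pair_of_one_lt_card (show 1 < Fintype.card κ by omega)
    refine ⟨fun u => if u = a then k else l, by simpa [hab.symm] using hkl, fun j => ?_, by simp⟩
    have hx := hx j
    have hy := hy j
    have hxy := hxy j
    simp only [mem_insert, notMem_empty, or_false] at hx hy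
    rcases hx with hx | hx <;> rcases hy with hy | hy <;>
      simp_all [hab.symm, hkl.symm]
  | succ n ih =>
    -- If the pair of `d` and its parent `z` need not be separated, `d` can copy `z`. The map `μ`
    -- contracts `d` to `z`; no required pair collapses and ranks of parents do not increase, so
    -- induction applies.
    by_cases hcontr : ∃ d ∈ A, ∃ z, (z = p d ∨ z = q d) ∧ (∀ j, s(x j, y j) ≠ s(d, z)) ∧
        ∀ d' ∈ A, s(p d', q d') ≠ s(d, z)
    · obtain ⟨d, hd, z, hz, hj, hd'⟩ := hcontr
      have hrz : rank z < rank d := by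
        rcases hz with rfl | rfl
        exacts [hrp d hd, hrq d hd]
      have hzd : z ≠ d := fun h => by simp [h] at hrz
      have hzU : z ∈ insert a (insert b A) := by
        rcases hz with rfl | rfl
        exacts [hp d hd, hq d hd]
      set μ : D → D := fun u => if u = d then z else u with hμ
      have hμne : ∀ u, u ≠ d → μ u = u := fun u hu => by simp [hμ, hu]
      have hμd : μ d = z := by simp [hμ]
      have hμinj : ∀ u v, u ≠ v → s(u, v) ≠ s(d, z) → μ u ≠ μ v := by
        intro u v huv h
        by_cases h1 : u = d <;> by_cases h2 : v = d
        · exact absurd (h1.trans h2.symm) huv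
        · rw [h1, hμd, hμne v h2]
          rintro rfl
          exact h (by rw [h1])
        · rw [h2, hμd, hμne u h1]
          rintro rfl
          exact h (by rw [h2, Sym2.eq_swap])
        · rwa [hμne u h1, hμne v h2]
      have hμU : ∀ u ∈ insert a (insert b A), μ u ∈ insert a (insert b (A.erase d)) := by
        intro u hu
        by_cases h1 : u = d
        · rw [h1, hμd]
          simp only [mem_insert, mem_erase] at hzU ⊢
          tauto
        · rw [hμne u h1]
          simp only [mem_insert, mem_erase] at hu ⊢
          tauto
      have hμr : ∀ u, rank (μ u) ≤ rank u := by
        intro u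
        by_cases h1 : u = d
        · rw [h1, hμd]; exact hrz.le
        · rw [hμne u h1]
      have hA : ∀ d' ∈ A.erase d, d' ∈ A := fun d' h => mem_of_mem_erase h
      obtain ⟨c, hcab, hcxy, hc⟩ := ih (A.erase d) (fun h => ha (hA _ h)) (fun h => hb (hA _ h))
        (μ ∘ p) (μ ∘ q) (μ ∘ x) (μ ∘ y)
        (fun d' h => hμinj _ _ (hpq d' (hA d' h)) (hd' d' (hA d' h)))
        (fun d' h => hμU _ (hp d' (hA d' h))) (fun d' h => hμU _ (hq d' (hA d' h)))
        (fun d' h => (hμr _).trans_lt (hrp d' (hA d' h)))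
        (fun d' h => (hμr _).trans_lt (hrq d' (hA d' h)))
        (fun j => hμinj _ _ (hxy j) (hj j)) (fun j => hμU _ (hx j)) (fun j => hμU _ (hy j))
        (by rw [card_erase_of_mem hd, hn]; rfl)
      refine ⟨c ∘ μ, ?_, hcxy, fun d' h heq => ?_⟩
      · rw [Function.comp_apply, Function.comp_apply, hμne a fun h => ha (h ▸ hd),
          hμne b fun h => hb (h ▸ hd)]
        exact hcab
      · by_cases h1 : d' = d
        · subst h1
          have hpd : p d' ≠ d' := fun h2 => by have := hrp d' h; rw [h2] at this; omega
          have hqd : q d' ≠ d' := fun h2 => by have := hrq d' h; rw [h2] at this; omega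
          simp only [Function.comp_apply, hμd, hμne _ hpd, hμne _ hqd] at heq ⊢
          rcases hz with rfl | rfl
          exacts [rfl, heq.symm]
        · have := hc d' (mem_erase.mpr ⟨h1, h⟩) heq
          simpa only [Function.comp_apply, hμne _ h1] using this
    push Not at hcontr
    set U := insert a (insert b A) with hU
    -- The graph joins every pair to be separated: the `t` receiver pairs and one pair of parents
    -- for each item of `A`. As nothing can be contracted, each item is also adjacent to both of its
    -- parents.
    let pr : Fin t ⊕ A → D × D := Sum.elim (fun j => (x j, y j)) fun d => (p d, q d)
    let T : Finset (D × D) := univ.image pr ∪ univ.image fun i => (pr i).swap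
    have hTmem : ∀ u v, (u, v) ∈ T ↔ ∃ i, s((pr i).1, (pr i).2) = s(u, v) := by
      intro u v
      simp only [T, mem_union, mem_image, mem_univ, true_and, ← exists_or]
      refine exists_congr fun i => ?_
      rw [Sym2.eq_iff, Prod.ext_iff, Prod.ext_iff]
      simp only [Prod.fst_swap, Prod.snd_swap]
      tauto
    have hsymm : ∀ u v, (u, v) ∈ T → (v, u) ∈ T := by
      intro u v h
      rw [hTmem] at h ⊢
      rwa [Sym2.eq_swap]
    have hirr : ∀ u, (u, u) ∉ T := by
      intro u h
      obtain ⟨i, hi⟩ := (hTmem _ _).mp h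
      rw [Sym2.eq_iff] at hi
      have : (pr i).1 = (pr i).2 := by rcases hi with h | h <;> rw [h.1, h.2]
      rcases i with j | d
      exacts [hxy j this, hpq d d.2 this]
    have hflow : ∀ d ∈ A, (p d, q d) ∈ T := fun d hd => (hTmem _ _).mpr ⟨.inr ⟨d, hd⟩, rfl⟩
    have hparent : ∀ d ∈ A, ∀ z, z = p d ∨ z = q d → (d, z) ∈ T := by
      intro d hd z hz
      rw [hTmem]
      by_contra! h
      obtain ⟨d', hd', h'⟩ := hcontr d hd z hz fun j => h (.inl j)
      exact h (.inr ⟨d', hd'⟩) h'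
    have htwo : ∀ u v w, v ∈ U → w ∈ U → v ≠ w → (u, v) ∈ T → (u, w) ∈ T →
        2 ≤ #{v ∈ U | (u, v) ∈ T} := by
      intro u v w hv hw hvw h1 h2
      rw [← card_pair hvw]
      refine card_le_card fun z hz => ?_
      rcases mem_insert.mp hz with rfl | hz
      · exact mem_filter.mpr ⟨hv, h1⟩
      · rw [mem_singleton.mp hz]
        exact mem_filter.mpr ⟨hw, h2⟩
    -- An item of least rank has parents `a` and `b`. The resulting triangle shows that `a` and `b`
    -- are adjacent and have degree at least two.
    obtain ⟨d₀, hd₀, hmin⟩ := exists_min_image A rank (card_pos.mp (by omega))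
    have hnotA : ∀ z, rank z < rank d₀ → z ∉ A := fun z hz h => absurd (hmin z h) (not_le.mpr hz)
    have hpd₀ : p d₀ = a ∨ p d₀ = b := by
      have h1 := hp d₀ hd₀
      have h2 := hnotA _ (hrp d₀ hd₀)
      simp only [hU, mem_insert] at h1
      tauto
    have hqd₀ : q d₀ = a ∨ q d₀ = b := by
      have h1 := hq d₀ hd₀
      have h2 := hnotA _ (hrq d₀ hd₀)
      simp only [hU, mem_insert] at h1
      tauto
    have hTab : (a, b) ∈ T ∧ (d₀, a) ∈ T ∧ (d₀, b) ∈ T := by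
      have h0 := hpq d₀ hd₀
      have h1 := hflow d₀ hd₀
      have h2 := hparent d₀ hd₀ _ (.inl rfl)
      have h3 := hparent d₀ hd₀ _ (.inr rfl)
      rcases hpd₀ with h | h <;> rcases hqd₀ with h' | h' <;> rw [h, h'] at h0 h1 <;>
        rw [h] at h2 <;> rw [h'] at h3
      · exact absurd rfl h0
      · exact ⟨h1, h2, h3⟩
      · exact ⟨hsymm _ _ h1, h3, h2⟩
      · exact absurd rfl h0
    have haU : a ∈ U := by simp [hU]
    have hbU : b ∈ U := by simp [hU]
    have hAU : ∀ d ∈ A, d ∈ U := fun d hd => by simp [hU, hd]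
    have hdeg : ∀ v ∈ U, 2 ≤ #{u ∈ U | (v, u) ∈ T} := by
      intro v hv
      rw [hU, mem_insert, mem_insert] at hv
      rcases hv with rfl | rfl | hv
      · exact htwo v b d₀ hbU (hAU _ hd₀) (fun h => hb (h ▸ hd₀)) hTab.1 (hsymm _ _ hTab.2.1)
      · exact htwo v a d₀ haU (hAU _ hd₀) (fun h => ha (h ▸ hd₀)) (hsymm _ _ hTab.1)
          (hsymm _ _ hTab.2.2)
      · exact htwo v _ _ (hp v hv) (hq v hv) (hpq v hv) (hparent v hv _ (.inl rfl))
          (hparent v hv _ (.inr rfl))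
    have hUcard : #U = #A + 2 := by
      rw [hU, card_insert_of_notMem (by simp [hab, ha]), card_insert_of_notMem hb]
    have hTcard : #T ≤ 2 * (t + #A) := by
      refine (card_union_le _ _).trans ?_
      have h1 : #(univ.image pr) ≤ t + #A := card_image_le.trans (by simp)
      have h2 : #(univ.image fun i => (pr i).swap) ≤ t + #A := card_image_le.trans (by simp)
      omega
    obtain ⟨c, hc⟩ := exists_coloring_of_card_le hκ ht T hsymm hirr U hUcard hdeg hTcard
    -- The copying condition is vacuous here, since the two parents of every item are adjacent.
    exact ⟨c, hc a haU b hbU hTab.1,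
      fun j => hc _ (hx j) _ (hy j) ((hTmem _ _).mpr ⟨.inl j, rfl⟩),
      fun d hd h => absurd h (hc _ (hp d hd) _ (hq d hd) (hflow d hd))⟩

end Coloring
-- Entropy, independence and the wiretapper
section Entropy

open Finset InformationTheory

theorem map_apply_toReal {Ω β : Type*} [Fintype Ω] [DecidableEq β] (p : PMF Ω) (g : Ω → β)
    (b : β) : (p.map g b).toReal = ∑ ω with g ω = b, (p ω).toReal := by
  rw [PMF.map_apply, tsum_fintype, sum_filter, ENNReal.toReal_sum]
  · refine sum_congr rfl fun ω _ => ?_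
    by_cases h : g ω = b
    · simp [h]
    · simp [h, Ne.symm h]
  · intro ω _
    split_ifs
    exacts [p.apply_ne_top ω, ENNReal.zero_ne_top]

theorem sum_toReal {Ω : Type*} [Fintype Ω] (p : PMF Ω) : ∑ ω, (p ω).toReal = 1 := by
  rw [← ENNReal.toReal_sum fun ω _ => p.apply_ne_top ω, ← tsum_fintype (L := .unconditional _),
    p.tsum_coe, ENNReal.toReal_one]

section

variable {Ω α β : Type*} [Fintype Ω] (p : PMF Ω) (X : Ω → α) (Z : Ω → β)

theorem map_fst_toReal [Fintype β] (x : α) :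
    (p.map X x).toReal = ∑ z, (p.map (fun ω => (X ω, Z ω)) (x, z)).toReal := by
  classical
  simp_rw [map_apply_toReal, Prod.mk.injEq, ← filter_filter]
  convert (sum_fiberwise {ω | X ω = x} Z fun ω => (p ω).toReal).symm

theorem map_snd_toReal [Fintype α] (z : β) :
    (p.map Z z).toReal = ∑ x, (p.map (fun ω => (X ω, Z ω)) (x, z)).toReal := by
  classical
  simp_rw [map_apply_toReal, Prod.mk.injEq, and_comm (b := Z _ = z), ← filter_filter]
  convert (sum_fiberwise {ω | Z ω = z} X fun ω => (p ω).toReal).symm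

variable [Fintype α] [Fintype β]

/-- The mutual information as a Kullback-Leibler divergence. -/
theorem entropy_sub_condEntropy :
    entropy (p.map X) - condEntropy p X Z = ∑ x, ∑ z,
      (p.map X x).toReal * (p.map Z z).toReal *
        klFun ((p.map (fun ω => (X ω, Z ω)) (x, z)).toReal /
          ((p.map X x).toReal * (p.map Z z).toReal)) := by
  set P : α → β → ℝ := fun x z => (p.map (fun ω => (X ω, Z ω)) (x, z)).toReal with hP
  set a : α → ℝ := fun x => (p.map X x).toReal with ha
  set b : β → ℝ := fun z => (p.map Z z).toReal with hb
  have hP0 : ∀ x z, 0 ≤ P x z := fun x z => ENNReal.toReal_nonneg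
  have haP : ∀ x, a x = ∑ z, P x z := map_fst_toReal p X Z
  have hbP : ∀ z, b z = ∑ x, P x z := map_snd_toReal p X Z
  have ha1 : ∑ x, a x = 1 := sum_toReal _
  have hb1 : ∑ z, b z = 1 := sum_toReal _
  -- The correction `a x * b z - P x z` comes from `klFun u = u * log u + 1 - u`; it cancels in the
  -- total because both laws have mass one.
  have hterm : ∀ x z, a x * b z * klFun (P x z / (a x * b z)) =
      -Real.negMulLog (P x z) - P x z * Real.log (a x) - P x z * Real.log (b z) + a x * b z
        - P x z := by
    intro x z
    rcases (hP0 x z).eq_or_lt with h | h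
    · simp [← h, klFun_zero]
    · have hax : 0 < a x := h.trans_le <| by
        rw [haP]; exact single_le_sum (f := P x) (fun z _ => hP0 x z) (mem_univ z)
      have hbz : 0 < b z := h.trans_le <| by
        rw [hbP]; exact single_le_sum (f := fun x => P x z) (fun x _ => hP0 x z) (mem_univ x)
      rw [klFun_apply, Real.log_div h.ne' (by positivity), Real.log_mul hax.ne' hbz.ne',
        Real.negMulLog]
      field_simp
      ring
  have e1 : entropy (p.map X) = -∑ x, ∑ z, P x z * Real.log (a x) := by
    rw [entropy, ← sum_neg_distrib]
    refine sum_congr rfl fun x _ => ?_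
    rw [← sum_mul, ← haP, Real.negMulLog, neg_mul]
  have e2 : entropy (p.map Z) = -∑ x, ∑ z, P x z * Real.log (b z) := by
    rw [entropy, sum_comm, ← sum_neg_distrib]
    refine sum_congr rfl fun z _ => ?_
    rw [← sum_mul, ← hbP, Real.negMulLog, neg_mul]
  have e3 : entropy (p.map fun ω => (X ω, Z ω)) = ∑ x, ∑ z, Real.negMulLog (P x z) := by
    rw [entropy, Fintype.sum_prod_type]
  have e4 : ∑ x, ∑ z, a x * b z = 1 := by
    rw [← sum_mul_sum, ha1, hb1, one_mul]
  have e5 : ∑ x, ∑ z, P x z = 1 := by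
    rw [← ha1]
    exact sum_congr rfl fun x _ => (haP x).symm
  change _ = ∑ x, ∑ z, a x * b z * klFun (P x z / (a x * b z))
  simp_rw [hterm, sum_sub_distrib, sum_add_distrib, sum_sub_distrib, sum_neg_distrib]
  rw [condEntropy, e1, e2, e3, e4, e5]
  ring

/-- Conditioning leaves the entropy unchanged exactly when the variables are independent. -/
theorem condEntropy_eq_entropy_iff :
    condEntropy p X Z = entropy (p.map X) ↔ ∀ x z,
      (p.map (fun ω => (X ω, Z ω)) (x, z)).toReal = (p.map X x).toReal * (p.map Z z).toReal := by
  rw [eq_comm, ← sub_eq_zero, entropy_sub_condEntropy]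
  have hnonneg : ∀ x z, 0 ≤ (p.map X x).toReal * (p.map Z z).toReal *
        klFun ((p.map (fun ω => (X ω, Z ω)) (x, z)).toReal /
          ((p.map X x).toReal * (p.map Z z).toReal)) :=
    fun x z => mul_nonneg (by positivity) (klFun_nonneg (by positivity))
  rw [sum_eq_zero_iff_of_nonneg fun x _ => sum_nonneg fun z _ => hnonneg x z]
  simp only [mem_univ, true_implies]
  refine forall_congr' fun x => ?_
  rw [sum_eq_zero_iff_of_nonneg fun z _ => hnonneg x z]
  simp only [mem_univ, true_implies]
  refine forall_congr' fun z => ?_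
  rw [mul_eq_zero, klFun_eq_zero_iff (by positivity)]
  -- A zero product gives the divergence term no weight, but independence still holds there: the
  -- joint mass is bounded by each marginal.
  by_cases h : (p.map X x).toReal * (p.map Z z).toReal = 0
  · simp only [h, true_or, true_iff]
    have h1 : (p.map (fun ω => (X ω, Z ω)) (x, z)).toReal ≤ (p.map X x).toReal := by
      rw [map_fst_toReal p X Z]
      exact single_le_sum (f := fun z => (p.map (fun ω => (X ω, Z ω)) (x, z)).toReal)
        (fun _ _ => ENNReal.toReal_nonneg) (mem_univ z)
    have h2 : (p.map (fun ω => (X ω, Z ω)) (x, z)).toReal ≤ (p.map Z z).toReal := by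
      rw [map_snd_toReal p X Z]
      exact single_le_sum (f := fun x => (p.map (fun ω => (X ω, Z ω)) (x, z)).toReal)
        (fun _ _ => ENNReal.toReal_nonneg) (mem_univ x)
    refine le_antisymm ?_ ENNReal.toReal_nonneg
    rcases mul_eq_zero.mp h with h | h
    exacts [h ▸ h1, h ▸ h2]
  · rw [div_eq_one_iff_eq h]
    simp only [h, false_or]

end

variable {F : Type*} [Field F] [Fintype F]

theorem jointLaw_apply_toReal (enc : F → PMF (Fin 2 → F)) (s : F) (y : Fin 2 → F) :
    (jointLaw enc (s, y)).toReal = (Fintype.card F : ℝ)⁻¹ * (enc s y).toReal := by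
  classical
  have h1 : ∀ s', (PMF.map (Prod.mk s') (enc s')) (s, y) = if s' = s then enc s y else 0 := by
    intro s'
    rw [PMF.map_apply]
    by_cases h : s' = s
    · subst h
      rw [tsum_eq_single y]
      · simp
      · intro y' hy'
        simp [hy'.symm]
    · simp [h, Ne.symm h]
  rw [jointLaw, PMF.bind_apply, tsum_eq_single s]
  · simp [h1]
  · intro s' hs'
    simp [h1, hs']

theorem jointLaw_map_fst_toReal (enc : F → PMF (Fin 2 → F)) (s : F) :
    ((jointLaw enc).map Prod.fst s).toReal = (Fintype.card F : ℝ)⁻¹ := by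
  classical
  rw [map_fst_toReal _ _ Prod.snd]
  simp_rw [show (fun ω : F × (Fin 2 → F) => (ω.1, ω.2)) = id from rfl, PMF.map_id,
    jointLaw_apply_toReal, ← mul_sum, sum_toReal, mul_one]

theorem entropy_jointLaw_map_fst_pos (enc : F → PMF (Fin 2 → F)) :
    0 < entropy ((jointLaw enc).map Prod.fst) := by
  have h : (1 : ℝ) < Fintype.card F := by exact_mod_cast Fintype.one_lt_card
  simp_rw [entropy, jointLaw_map_fst_toReal]
  refine sum_pos (fun _ _ => ?_) univ_nonempty
  rw [Real.negMulLog, Real.log_inv]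
  have := Real.log_pos h
  have : (0 : ℝ) < (Fintype.card F : ℝ)⁻¹ := by positivity
  nlinarith [mul_pos this (Real.log_pos h)]

/-- The joint law of the information symbol and of an observed packet. -/
theorem jointLaw_map_packet_toReal [DecidableEq F] (enc : F → PMF (Fin 2 → F)) (c : Fin 2 → F)
    (s z : F) : ((jointLaw enc).map (fun ω => (ω.1, c ⬝ᵥ ω.2)) (s, z)).toReal =
      ∑ y with c ⬝ᵥ y = z, (jointLaw enc (s, y)).toReal := by
  rw [map_apply_toReal, sum_filter, sum_filter, Fintype.sum_prod_type, sum_eq_single s]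
  · simp
  · intro s' _ hs'
    simp [hs']
  · simp

/-! ### The coset code -/

theorem oneOne_dotProduct {F : Type*} [Field F] (y : Fin 2 → F) : ![1, 1] ⬝ᵥ y = y 0 + y 1 := by
  simp [dotProduct, Fin.sum_univ_two]

theorem jointLaw_cosetEncoder_toReal [DecidableEq F] (s : F) (y : Fin 2 → F) :
    (jointLaw (cosetEncoder ![1, 1] oneOne_ne_zero) (s, y)).toReal =
      if y 0 + y 1 = s then ((Fintype.card F : ℝ) ^ 2)⁻¹ else 0 := by
  rw [jointLaw_apply_toReal, cosetEncoder, PMF.uniformOfFinset_apply]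
  simp only [mem_filter, mem_univ, true_and, oneOne_dotProduct]
  split_ifs with h
  · have hcard : #{y : Fin 2 → F | y 0 + y 1 = s} = Fintype.card F := by
      rw [← card_univ]
      refine card_bij' (fun y _ => y 0) (fun x _ => ![x, s - x]) ?_ ?_ ?_ ?_
      · simp
      · simp
      · intro y hy
        ext i
        fin_cases i
        · simp
        · simp [← (mem_filter.mp hy).2]
      · simp
    rw [ENNReal.toReal_inv, ENNReal.toReal_natCast]
    convert_to (Fintype.card F : ℝ)⁻¹ * ((#{y : Fin 2 → F | y 0 + y 1 = s} : ℕ) : ℝ)⁻¹ = _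
    rw [hcard, sq, mul_inv]
  · simp

theorem condEntropy_cosetEncoder_symbols :
    condEntropy (jointLaw (cosetEncoder (F := F) ![1, 1] oneOne_ne_zero)) Prod.fst Prod.snd = 0 := by
  classical
  rw [condEntropy, sub_eq_zero, show (fun ω : F × (Fin 2 → F) => (ω.1, ω.2)) = id from rfl,
    PMF.map_id, entropy, entropy, Fintype.sum_prod_type, sum_comm]
  refine sum_congr rfl fun y _ => ?_
  rw [map_snd_toReal _ Prod.fst]
  simp_rw [show (fun ω : F × (Fin 2 → F) => (ω.1, ω.2)) = id from rfl, PMF.map_id,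
    jointLaw_cosetEncoder_toReal, apply_ite Real.negMulLog, Real.negMulLog_zero]
  simp

/-- When `c 0 ≠ c 1`, the map `y ↦ (y 0 + y 1, c ⬝ᵥ y)` is a bijection of the plane, so symbol and
packet are jointly uniform. A zero packet is constant. -/
theorem condEntropy_cosetEncoder_packet {c : Fin 2 → F} (hc : c = 0 ∨ c 0 ≠ c 1) :
    condEntropy (jointLaw (cosetEncoder ![1, 1] oneOne_ne_zero)) Prod.fst (fun ω => c ⬝ᵥ ω.2) =
      entropy ((jointLaw (cosetEncoder (F := F) ![1, 1] oneOne_ne_zero)).map Prod.fst) := by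
  classical
  have hq : (Fintype.card F : ℝ) ≠ 0 := by simp
  rw [condEntropy_eq_entropy_iff]
  intro s z
  rcases hc with rfl | hc
  · rw [map_snd_toReal _ Prod.fst fun ω => (0 : Fin 2 → F) ⬝ᵥ ω.2,
      map_fst_toReal _ Prod.fst fun ω => (0 : Fin 2 → F) ⬝ᵥ ω.2]
    have hz : ∀ s z, z ≠ 0 → ((jointLaw (cosetEncoder (F := F) ![1, 1] oneOne_ne_zero)).map
        (fun ω => (ω.1, (0 : Fin 2 → F) ⬝ᵥ ω.2)) (s, z)).toReal = 0 := by
      intro s z hz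
      rw [jointLaw_map_packet_toReal]
      simp [hz.symm]
    have h1 : ∀ s, ((jointLaw (cosetEncoder (F := F) ![1, 1] oneOne_ne_zero)).map
        (fun ω => (ω.1, (0 : Fin 2 → F) ⬝ᵥ ω.2)) (s, 0)).toReal = (Fintype.card F : ℝ)⁻¹ := by
      intro s
      rw [← jointLaw_map_fst_toReal (cosetEncoder ![1, 1] oneOne_ne_zero) s,
        map_fst_toReal _ Prod.fst fun ω => (0 : Fin 2 → F) ⬝ᵥ ω.2]
      exact (sum_eq_single 0 (fun z _ h => hz s z h) fun h => absurd (mem_univ _) h).symm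
    by_cases h : z = 0
    · subst h
      rw [sum_eq_single 0 (fun z _ h => hz s z h) fun h => absurd (mem_univ _) h]
      simp only [h1, sum_const, card_univ, nsmul_eq_mul]
      field_simp
    · simp only [hz _ z h, sum_const_zero, mul_zero]
  · have hone : ∀ s z, ((jointLaw (cosetEncoder (F := F) ![1, 1] oneOne_ne_zero)).map
        (fun ω => (ω.1, c ⬝ᵥ ω.2)) (s, z)).toReal = ((Fintype.card F : ℝ) ^ 2)⁻¹ := by
      intro s z
      have hd : c 0 - c 1 ≠ 0 := sub_ne_zero.mpr hc
      rw [jointLaw_map_packet_toReal]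
      simp_rw [jointLaw_cosetEncoder_toReal]
      rw [← sum_filter, filter_filter, sum_const]
      have : ({y : Fin 2 → F | c ⬝ᵥ y = z ∧ y 0 + y 1 = s} : Finset _) =
          {![(z - c 1 * s) / (c 0 - c 1), (c 0 * s - z) / (c 0 - c 1)]} := by
        ext y
        simp only [mem_filter, mem_univ, true_and, mem_singleton, dotProduct, Fin.sum_univ_two]
        constructor
        · rintro ⟨rfl, rfl⟩
          ext i
          fin_cases i
          · simp only [Fin.zero_eta, Matrix.cons_val_zero]
            field_simp
            ring
          · simp only [Fin.mk_one, Matrix.cons_val_one, Matrix.cons_val_zero]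
            field_simp
            ring
        · rintro rfl
          simp only [Matrix.cons_val_zero, Matrix.cons_val_one]
          constructor <;> field_simp <;> ring
      rw [this]
      simp
    rw [hone, jointLaw_map_fst_toReal, map_snd_toReal _ Prod.fst fun ω => c ⬝ᵥ ω.2]
    simp_rw [hone]
    simp only [sum_const, card_univ, nsmul_eq_mul]
    field_simp

/-! ### A secure code misses a point of the projective line -/

/-- The points of the projective line. -/
def pointVector : Option F → Fin 2 → F
  | none => ![0, 1]
  | some x => ![1, x]

/-- A function on the affine plane whose sum over each line vanishes is zero. -/
theorem eq_zero_of_sum_line_eq_zero [DecidableEq F] (g : (Fin 2 → F) → ℝ)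
    (hsum : ∑ y, g y = 0)
    (hg : ∀ r : Option F, ∀ z, ∑ y with pointVector r ⬝ᵥ y = z, g y = 0) (y : Fin 2 → F) :
    g y = 0 := by
  -- All `q + 1` lines through `y` contain `y`, and exactly one of them contains a given other
  -- point. Summing `g` over these lines therefore yields the total sum plus `q * g y`.
  have hcount : ∀ v : Fin 2 → F, (#{r : Option F | pointVector r ⬝ᵥ v = pointVector r ⬝ᵥ y} : ℝ) =
      1 + if v = y then (Fintype.card F : ℝ) else 0 := by
    intro v
    split_ifs with h
    · subst h
      simp [add_comm]
    · have h1 : #{r : Option F | pointVector r ⬝ᵥ v = pointVector r ⬝ᵥ y} = 1 := by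
        rw [card_eq_one]
        by_cases hv : v 1 = y 1
        · have hv0 : v 0 ≠ y 0 := fun h0 => h <| by
            ext i
            fin_cases i
            exacts [h0, hv]
          refine ⟨none, ?_⟩
          ext r
          cases r <;> simp [pointVector, dotProduct, Fin.sum_univ_two, hv, hv0]
        · have hd : v 1 - y 1 ≠ 0 := sub_ne_zero.mpr hv
          refine ⟨some ((y 0 - v 0) / (v 1 - y 1)), ?_⟩
          ext r
          cases r with
          | none => simp [pointVector, dotProduct, Fin.sum_univ_two, hv]
          | some x =>
            simp only [pointVector, dotProduct, Fin.sum_univ_two, mem_filter, mem_univ, true_and,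
              Matrix.cons_val_zero, Matrix.cons_val_one, one_mul, mem_singleton,
              Option.some.injEq]
            rw [eq_div_iff hd]
            constructor <;> intro h' <;> linear_combination h'
      rw [h1]; simp
  have h0 : ∑ r : Option F, ∑ v with pointVector r ⬝ᵥ v = pointVector r ⬝ᵥ y, g v = 0 :=
    sum_eq_zero fun r _ => hg r _
  simp_rw [sum_filter] at h0
  rw [sum_comm] at h0
  simp_rw [← sum_filter, sum_const, nsmul_eq_mul, hcount, add_mul, one_mul, ite_mul, zero_mul,
    sum_add_distrib, hsum] at h0
  have hq : (Fintype.card F : ℝ) ≠ 0 := by simp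
  simpa [hq] using h0

/-- Otherwise some edge observes each parallel class of lines, and security makes `P(s, y) - P(s)
P(y)` sum to zero on every line. It then vanishes identically, so `H(S | Y) = H(S) > 0`. -/
theorem IsSecureCode.exists_point {V E : Type*} {N : Network V E} {t : ℕ} {R : Fin t → V}
    {enc : F → PMF (Fin 2 → F)} {f : E → Fin 2 → F} (h : IsSecureCode N R enc f) :
    ∃ r : Option F, ∀ e (a : F), a ≠ 0 → f e ≠ a • pointVector r := by
  classical
  by_contra! hall
  have hind : condEntropy (jointLaw enc) Prod.fst Prod.snd =
      entropy ((jointLaw enc).map Prod.fst) := by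
    rw [condEntropy_eq_entropy_iff]
    intro s y
    rw [jointLaw_map_fst_toReal, map_snd_toReal _ Prod.fst Prod.snd,
      show (fun ω : F × (Fin 2 → F) => (ω.1, ω.2)) = id from rfl, PMF.map_id, ← sub_eq_zero]
    refine eq_zero_of_sum_line_eq_zero (fun y => (jointLaw enc (s, y)).toReal -
      (Fintype.card F : ℝ)⁻¹ * ∑ s', (jointLaw enc (s', y)).toReal) ?_ (fun r z => ?_) y
    · rw [sum_sub_distrib, ← mul_sum, sum_comm]
      simp_rw [jointLaw_apply_toReal, ← mul_sum, sum_toReal]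
      simp
    · obtain ⟨e, a, ha, he⟩ := hall r
      have h1 := (condEntropy_eq_entropy_iff _ _ _).mp (h.secure e) s (a * z)
      rw [jointLaw_map_fst_toReal, map_snd_toReal _ Prod.fst fun ω => f e ⬝ᵥ ω.2] at h1
      have hline : ∀ y, f e ⬝ᵥ y = a * z ↔ pointVector r ⬝ᵥ y = z := fun y => by
        rw [he, smul_dotProduct, smul_eq_mul, mul_right_inj' ha]
      simp_rw [jointLaw_map_packet_toReal, hline] at h1
      rw [sum_sub_distrib, ← mul_sum, sum_comm, h1, sub_self]
  rw [h.recovers] at hind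
  exact (entropy_jointLaw_map_fst_pos enc).ne hind

end Entropy
-- Vectors in the plane and the points used as colours
section Plane

variable {F : Type*} [Field F]

theorem mem_span_pair_of_det_ne_zero {u w : Fin 2 → F} (h : u 0 * w 1 - u 1 * w 0 ≠ 0)
    (v : Fin 2 → F) : v ∈ Submodule.span F {u, w} := by
  rw [Submodule.mem_span_pair]
  refine ⟨(v 0 * w 1 - v 1 * w 0) / (u 0 * w 1 - u 1 * w 0),
    (u 0 * v 1 - u 1 * v 0) / (u 0 * w 1 - u 1 * w 0), ?_⟩
  ext i
  fin_cases i
  all_goals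
    simp only [Fin.zero_eta, Fin.mk_one, Pi.add_apply, Pi.smul_apply, smul_eq_mul]
    rw [div_mul_eq_mul_div, div_mul_eq_mul_div, ← add_div, div_eq_iff h]
    ring

theorem eq_of_dotProduct_eq_of_det_ne_zero {u w : Fin 2 → F} (h : u 0 * w 1 - u 1 * w 0 ≠ 0)
    {y y' : Fin 2 → F} (hu : u ⬝ᵥ y = u ⬝ᵥ y') (hw : w ⬝ᵥ y = w ⬝ᵥ y') : y = y' := by
  simp only [dotProduct, Fin.sum_univ_two] at hu hw
  ext i
  fin_cases i
  · refine mul_left_cancel₀ h ?_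
    simp only [Fin.zero_eta]
    linear_combination w 1 * hu - u 1 * hw
  · refine mul_left_cancel₀ h ?_
    simp only [Fin.mk_one]
    linear_combination u 0 * hw - w 0 * hu

open Classical in
/-- The points of the projective line other than `[1 1]`. -/
noncomputable def colorVector (x : F) : Fin 2 → F :=
  if x = 1 then ![0, 1] else ![1, x]

theorem colorVector_det_ne_zero {x y : F} (h : x ≠ y) :
    colorVector x 0 * colorVector y 1 - colorVector x 1 * colorVector y 0 ≠ 0 := by
  unfold colorVector
  split_ifs with hx hy hy
  · exact absurd (hx.trans hy.symm) h
  · simp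
  · simp
  · simpa [sub_eq_zero] using h.symm

theorem colorVector_apply_ne (x : F) : colorVector x 0 ≠ colorVector x 1 := by
  unfold colorVector
  split_ifs with hx
  · simp
  · simpa using Ne.symm hx

end Plane

/-! ### Information flows and the code built from a colouring -/

namespace Network

variable {V E : Type*} (N : Network V E)

theorem exists_rank [Finite V] : ∃ rank : V → ℕ, ∀ e, rank (N.tail e) < rank (N.head e) := by
  let r : V → V → Prop := fun u w => ∃ e, N.tail e = u ∧ N.head e = w
  refine ⟨fun v => {u | Relation.TransGen r u v}.ncard, fun e => ?_⟩
  have he : Relation.TransGen r (N.tail e) (N.head e) := .single ⟨e, rfl, rfl⟩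
  refine Set.ncard_lt_ncard ⟨fun u hu => hu.trans he, fun h => ?_⟩ (Set.toFinite _)
  exact N.acyclic _ (h he)

/-- The roots of the symbols available at `v`, when `root e` is the root of the edge `e`. -/
def rootsAt (root : E → Option (E ⊕ Fin 2)) (v : V) : Set (E ⊕ Fin 2) :=
  {d | (∃ e, N.head e = v ∧ root e = some d) ∨ ∃ i, N.source i = v ∧ Sum.inr i = d}

/-- `root` assigns to each edge the edge or source that starts its information flow: an edge
whose tail receives several flows starts one of its own, and any other edge continues the one
flow into its tail. -/
def IsFlowDecomposition (root : E → Option (E ⊕ Fin 2)) : Prop :=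
  ∀ e, (¬ (N.rootsAt root (N.tail e)).Subsingleton → root e = some (.inl e)) ∧
    ((N.rootsAt root (N.tail e)).Subsingleton →
      ∀ d, root e = some d ↔ d ∈ N.rootsAt root (N.tail e))

theorem exists_isFlowDecomposition [Finite V] : ∃ root, N.IsFlowDecomposition root := by
  classical
  obtain ⟨rank, hrank⟩ := N.exists_rank
  -- The root of an edge depends only on the roots of the edges into its tail, whose own tails have
  -- smaller rank, so it is defined by well-founded recursion.
  have hwf : WellFounded fun e e' : E => N.head e = N.tail e' :=
    Subrelation.wf (r := InvImage (· < ·) fun e => rank (N.tail e))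
      (fun {e e'} h => show rank (N.tail e) < rank (N.tail e') from h ▸ hrank e)
      (InvImage.wf _ wellFounded_lt)
  let S : (e : E) → ((e' : E) → N.head e' = N.tail e → Option (E ⊕ Fin 2)) → Set (E ⊕ Fin 2) :=
    fun e g => {d | (∃ e', ∃ h : N.head e' = N.tail e, g e' h = some d) ∨
      ∃ i, N.source i = N.tail e ∧ Sum.inr i = d}
  let step : (e : E) → ((e' : E) → N.head e' = N.tail e → Option (E ⊕ Fin 2)) →
      Option (E ⊕ Fin 2) := fun e g =>
    if (S e g).Subsingleton then if h : (S e g).Nonempty then some h.some else none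
    else some (.inl e)
  let root := hwf.fix step
  have hS : ∀ e, S e (fun e' _ => root e') = N.rootsAt root (N.tail e) := by
    intro e
    ext d
    simp only [S, rootsAt, Set.mem_ofPred_eq, exists_prop]
  have hroot : ∀ e, root e = step e fun e' _ => root e' := fun e => hwf.fix_eq step e
  refine ⟨root, fun e => ?_⟩
  have he := hroot e
  simp only [step, hS] at he
  constructor
  · intro h
    rw [he, if_neg h]
  · intro h d
    rw [he, if_pos h]
    split_ifs with hne
    · rw [Option.some_inj]
      exact ⟨fun hd => hd ▸ hne.some_mem, fun hd => h hne.some_mem hd⟩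
    · simp only [false_iff]
      exact fun hd => hne ⟨d, hd⟩

namespace IsFlowDecomposition

variable {N} {root : E → Option (E ⊕ Fin 2)} (h : N.IsFlowDecomposition root)
include h

theorem eq_inl_or_mem {e : E} {d : E ⊕ Fin 2} (hd : root e = some d) :
    d = .inl e ∨ d ∈ N.rootsAt root (N.tail e) := by
  by_cases hs : (N.rootsAt root (N.tail e)).Subsingleton
  · exact .inr (((h e).2 hs d).mp hd)
  · exact .inl (Option.some_inj.mp (hd.symm.trans ((h e).1 hs)))

/-- Following a flow backwards lowers the rank of the tail until an edge that starts the flow, or a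
source, is reached. -/
theorem root_spec {rank : V → ℕ} (hrank : ∀ e, rank (N.tail e) < rank (N.head e)) {e : E}
    {d : E ⊕ Fin 2} (hd : root e = some d) :
    (∃ e', d = .inl e' ∧ root e' = some (.inl e') ∧ rank (N.tail e') ≤ rank (N.tail e)) ∨
      ∃ i, d = .inr i := by
  induction hn : rank (N.tail e) using Nat.strong_induction_on generalizing e with
  | _ n ih =>
    subst hn
    obtain rfl | ⟨e', he', hd'⟩ | ⟨i, -, rfl⟩ := h.eq_inl_or_mem hd
    · exact .inl ⟨e, rfl, hd, le_rfl⟩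
    · have hlt : rank (N.tail e') < rank (N.tail e) := he' ▸ hrank e'
      obtain ⟨e'', h1, h2, h3⟩ | hi := ih _ hlt hd' rfl
      · exact .inl ⟨e'', h1, h2, h3.trans hlt.le⟩
      · exact .inr hi
    · exact .inr ⟨i, rfl⟩

theorem rootsAt_spec {rank : V → ℕ} (hrank : ∀ e, rank (N.tail e) < rank (N.head e)) {v : V}
    {d : E ⊕ Fin 2} (hd : d ∈ N.rootsAt root v) :
    (∃ e', d = .inl e' ∧ root e' = some (.inl e') ∧ rank (N.tail e') < rank v) ∨
      ∃ i, d = .inr i := by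
  obtain ⟨e, rfl, he⟩ | ⟨i, -, rfl⟩ := hd
  · obtain ⟨e', h1, h2, h3⟩ | hi := h.root_spec hrank he
    exacts [.inl ⟨e', h1, h2, h3.trans_lt (hrank e)⟩, .inr hi]
  · exact .inr ⟨i, rfl⟩

/-- With a single flow at its tail, `e` would continue a flow started strictly earlier, which cannot
be its own. -/
theorem not_subsingleton_of_root_eq [Finite V] {e : E} (he : root e = some (.inl e)) :
    ¬ (N.rootsAt root (N.tail e)).Subsingleton := by
  obtain ⟨rank, hrank⟩ := N.exists_rank
  intro hs
  obtain ⟨e', h1, -, h3⟩ | ⟨i, hi⟩ := h.rootsAt_spec hrank (((h e).2 hs _).mp he)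
  · rw [Sum.inl.inj h1] at h3
    exact lt_irrefl _ h3
  · exact Sum.inl_ne_inr hi

/-- A node with a single information flow has minimum cut at most one. -/
theorem not_subsingleton_of_minCut [Finite E] {v : V} (hv : 2 ≤ N.minCut v) :
    ¬ (N.rootsAt root v).Subsingleton := by
  intro hs
  obtain ⟨d, hd⟩ : ∃ d, N.rootsAt root v ⊆ {d} := by
    obtain h0 | ⟨d, hd⟩ := hs.eq_empty_or_singleton
    exacts [⟨.inr 0, by simp [h0]⟩, ⟨d, hd.subset⟩]
  -- Only the start of the flow `d` crosses this cut. An edge leaving `X` whose tail has one flow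
  -- would carry a flow other than `d` out of `X`, so it must start a flow, and that flow is `d`.
  let X : Set V := {u | ¬ N.rootsAt root u ⊆ {d}}
  have hedge : ∀ e ∈ N.edgesOut X, Sum.inl e = d := by
    intro e he
    have h1 : ¬ N.rootsAt root (N.tail e) ⊆ {d} := he.1
    have h2 : N.rootsAt root (N.head e) ⊆ {d} := not_not.mp he.2
    by_cases hs' : (N.rootsAt root (N.tail e)).Subsingleton
    · obtain ⟨d', hd', hne⟩ := Set.not_subset.mp h1
      exact absurd (h2 (.inl ⟨e, rfl, ((h e).2 hs' d').mpr hd'⟩)) hne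
    · exact h2 (.inl ⟨e, rfl, (h e).1 hs'⟩)
  have hsource : ∀ i ∈ {i | N.source i ∉ X}, Sum.inr i = d := fun i hi =>
    not_not.mp hi (.inr ⟨i, rfl, rfl⟩)
  have hle : N.minCut v ≤ (N.edgesOut X).ncard + {i | N.source i ∉ X}.ncard :=
    Nat.sInf_le ⟨X, not_not.mpr hd, rfl⟩
  have hone : (N.edgesOut X).ncard + {i | N.source i ∉ X}.ncard ≤ 1 := by
    rcases d with e | i
    · have h1 : (N.edgesOut X).ncard ≤ 1 := (Set.ncard_le_one (Set.toFinite _)).mpr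
        fun a ha b hb => Sum.inl.inj ((hedge a ha).trans (hedge b hb).symm)
      have h2 : {i | N.source i ∉ X} = ∅ :=
        Set.eq_empty_of_forall_notMem fun i hi => Sum.inr_ne_inl (hsource i hi)
      rw [h2, Set.ncard_empty]
      exact h1
    · have h1 : {i | N.source i ∉ X}.ncard ≤ 1 := (Set.ncard_le_one (Set.toFinite _)).mpr
        fun a ha b hb => Sum.inr.inj ((hsource a ha).trans (hsource b hb).symm)
      have h2 : N.edgesOut X = ∅ :=
        Set.eq_empty_of_forall_notMem fun e he => Sum.inl_ne_inr (hedge e he)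
      rw [h2, Set.ncard_empty, zero_add]
      exact h1
  omega

end IsFlowDecomposition

variable {N}

theorem IsConfiguration.exists_code [Finite V] [Finite E] {F : Type*} [Field F] [Fintype F] {t : ℕ}
    {R : Fin t → V} (hR : N.IsConfiguration R) (ht : t ≤ (Fintype.card F).choose 2) :
    ∃ f : E → Fin 2 → F, N.IsLinearCode f ∧ (∀ j, N.Decodes f (R j)) ∧
      ∀ e, f e = 0 ∨ f e 0 ≠ f e 1 := by
  classical
  have := Fintype.ofFinite E
  obtain ⟨rank, hrank⟩ := N.exists_rank
  obtain ⟨root, hroot⟩ := N.exists_isFlowDecomposition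
  set A : Finset (E ⊕ Fin 2) :=
    (Finset.univ.filter fun e => root e = some (.inl e)).map .inl with hA
  have hAmem : ∀ d, d ∈ A ↔ ∃ e, root e = some (.inl e) ∧ Sum.inl e = d := by simp [hA]
  have hmem : ∀ v, ∀ d ∈ N.rootsAt root v, d ∈ insert (.inr 0) (insert (.inr 1) A) := by
    intro v d hd
    rw [Finset.mem_insert, Finset.mem_insert, hAmem]
    obtain ⟨e, rfl, he, -⟩ | ⟨i, rfl⟩ := hroot.rootsAt_spec hrank hd
    · exact .inr (.inr ⟨e, he, rfl⟩)
    · fin_cases i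
      exacts [.inl rfl, .inr (.inl rfl)]
  -- The `+ 1` puts the sources below every edge, even one whose tail has rank `0`.
  let rk : E ⊕ Fin 2 → ℕ := Sum.elim (fun e => rank (N.tail e) + 1) fun _ => 0
  have hrk : ∀ e, ∀ d ∈ N.rootsAt root (N.tail e), rk d < rk (.inl e) := by
    intro e d hd
    obtain ⟨e', rfl, -, he'⟩ | ⟨i, rfl⟩ := hroot.rootsAt_spec hrank hd
    · exact Nat.succ_lt_succ he'
    · exact Nat.succ_pos _
  have hparents : ∀ d : E ⊕ Fin 2, ∃ p q, d ∈ A → p ≠ q ∧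
      ∃ e, d = .inl e ∧ p ∈ N.rootsAt root (N.tail e) ∧ q ∈ N.rootsAt root (N.tail e) := by
    intro d
    by_cases hd : d ∈ A
    · obtain ⟨e, he, rfl⟩ := (hAmem d).mp hd
      obtain ⟨p, hp, q, hq, hpq⟩ := Set.not_subsingleton_iff.mp
        (hroot.not_subsingleton_of_root_eq he)
      exact ⟨p, q, fun _ => ⟨hpq, e, rfl, hp, hq⟩⟩
    · exact ⟨d, d, fun h => absurd h hd⟩
  choose p q hpq using hparents
  have hreceivers : ∀ j, ∃ x y, x ≠ y ∧ x ∈ N.rootsAt root (R j) ∧ y ∈ N.rootsAt root (R j) := by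
    intro j
    obtain ⟨x, hx, y, hy, hxy⟩ := Set.not_subsingleton_iff.mp
      (hroot.not_subsingleton_of_minCut (hR.2 j).ge)
    exact ⟨x, y, hxy, hx, hy⟩
  choose x y hxy hx hy using hreceivers
  obtain ⟨c, hc01, hcR, hcA⟩ := exists_coloring (κ := F) Fintype.one_lt_card ht
    (a := .inr 0) (b := .inr 1) (by simp) rk A (by simp [hA]) (by simp [hA]) p q x y
    (fun d hd => (hpq d hd).1)
    (fun d hd => by obtain ⟨-, e, rfl, h, -⟩ := hpq d hd; exact hmem _ _ h)
    (fun d hd => by obtain ⟨-, e, rfl, -, h⟩ := hpq d hd; exact hmem _ _ h)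
    (fun d hd => by obtain ⟨-, e, h', h, -⟩ := hpq d hd; rw [h'] at h ⊢; exact hrk _ _ h)
    (fun d hd => by obtain ⟨-, e, h', -, h⟩ := hpq d hd; rw [h'] at h ⊢; exact hrk _ _ h)
    hxy (fun j => hmem _ _ (hx j)) (fun j => hmem _ _ (hy j))
  -- The colours are permuted so that the sources get `0` and `1`, for which `colorVector` is `[1
  -- 0]` and `[0 1]`, the unit vectors.
  obtain ⟨σ, hσ0, hσ1⟩ : ∃ σ : Equiv.Perm F, σ (c (.inr 0)) = 0 ∧ σ (c (.inr 1)) = 1 := by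
    have h1 : Equiv.swap (c (.inr 0)) 0 (c (.inr 1)) ≠ 0 := fun h => hc01 <|
      (Equiv.swap (c (.inr 0)) 0).injective ((Equiv.swap_apply_left _ _).trans h.symm)
    refine ⟨(Equiv.swap (c (.inr 0)) 0).trans
      (Equiv.swap (Equiv.swap (c (.inr 0)) 0 (c (.inr 1))) 1), ?_, ?_⟩
    · rw [Equiv.trans_apply, Equiv.swap_apply_left,
        Equiv.swap_apply_of_ne_of_ne h1.symm zero_ne_one]
    · rw [Equiv.trans_apply, Equiv.swap_apply_left]
  let w : E ⊕ Fin 2 → Fin 2 → F := fun d => colorVector (σ (c d))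
  let f : E → Fin 2 → F := fun e => (root e).elim 0 w
  have hf : ∀ e d, root e = some d → f e = w d := fun e d h => by simp [f, h]
  have hsource : ∀ i, w (.inr i) = Pi.single i 1 := by
    intro i
    fin_cases i
    · ext j
      fin_cases j <;> simp [w, colorVector, hσ0]
    · ext j
      fin_cases j <;> simp [w, colorVector, hσ1]
  have hinput : ∀ v, ∀ d ∈ N.rootsAt root v, w d ∈ N.inputs f v := by
    rintro v d (⟨e, he, hd⟩ | ⟨i, hi, rfl⟩)
    · exact .inl ⟨e, he, hf e d hd⟩
    · exact .inr ⟨i, hi, (hsource i).symm⟩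
  have hdet : ∀ d d', c d ≠ c d' → w d 0 * w d' 1 - w d 1 * w d' 0 ≠ 0 := fun d d' h =>
    colorVector_det_ne_zero (σ.injective.ne h)
  refine ⟨f, fun e => ?_, fun j y₁ y₂ hy₁₂ => ?_, fun e => ?_⟩
  · rcases he : root e with _ | d
    · have : f e = 0 := by simp [f, he]
      rw [this]
      exact Submodule.zero_mem _
    · rw [hf e d he]
      obtain rfl | hd := hroot.eq_inl_or_mem he
      · obtain ⟨-, e', hee', hp, hq⟩ := hpq (.inl e) ((hAmem _).mpr ⟨e, he, rfl⟩)
        obtain rfl := Sum.inl.inj hee'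
        -- Parents of equal colour are copied; parents of different colours span the plane, so any
        -- vector is available.
        by_cases hcpq : c (p (.inl e)) = c (q (.inl e))
        · have hce : w (.inl e) = w (p (.inl e)) := by
            simp only [w, hcA _ ((hAmem _).mpr ⟨e, he, rfl⟩) hcpq]
          rw [hce]
          exact Submodule.subset_span (hinput _ _ hp)
        · refine Submodule.span_mono ?_ (mem_span_pair_of_det_ne_zero (hdet _ _ hcpq) _)
          exact Set.insert_subset (hinput _ _ hp) (Set.singleton_subset_iff.mpr (hinput _ _ hq))
      · exact Submodule.subset_span (hinput _ _ hd)
  · exact eq_of_dotProduct_eq_of_det_ne_zero (hdet _ _ (hcR j)) (hy₁₂ _ (hinput _ _ (hx j)))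
      (hy₁₂ _ (hinput _ _ (hy j)))
  · rcases he : root e with _ | d
    · exact .inl (by simp [f, he])
    · exact .inr (by rw [hf e d he]; exact colorVector_apply_ne _)

end Network

/-- Squaring `√(2t - 7/4) < q - 1/2` gives `2t < q(q - 1) + 2`, and integrality does the rest. -/
theorem le_choose_of_alphabetSize_le {t q : ℕ} (h : alphabetSize t ≤ q) : t ≤ q.choose 2 := by
  rw [alphabetSize, Nat.succ_le_iff, Nat.floor_lt (by positivity)] at h
  have hq : 1 ≤ q := by
    by_contra! h0
    rw [Nat.lt_one_iff.mp h0, Nat.cast_zero] at h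
    have := Real.sqrt_nonneg (2 * (t : ℝ) - 7 / 4)
    linarith
  have h1 : √(2 * (t : ℝ) - 7 / 4) < q - 1 / 2 := by linarith
  have h2 : (0 : ℝ) < q - 1 / 2 := (Real.sqrt_nonneg _).trans_lt h1
  rw [Real.sqrt_lt' h2] at h1
  have hch : 2 * q.choose 2 = q * (q - 1) := by
    rw [Nat.choose_two_right, Nat.mul_div_cancel' (Nat.even_mul_pred_self q).two_dvd]
  have hch' : (2 * q.choose 2 : ℝ) = q * (q - 1) := by
    have := congrArg (Nat.cast (R := ℝ)) hch
    push_cast [Nat.cast_sub hq] at this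
    exact this
  have h3 : (t : ℝ) < q.choose 2 + 1 := by nlinarith
  exact Nat.lt_succ_iff.mp (by exact_mod_cast h3)

theorem exists_alphabetSize_eq {t : ℕ} (ht : 1 ≤ t) :
    ∃ n, alphabetSize t = n + 2 ∧ (n + 1).choose 2 + 1 ≤ t := by
  have ht' : (1 : ℝ) ≤ t := by exact_mod_cast ht
  have h0 : 1 ≤ ⌊√(2 * (t : ℝ) - 7 / 4) + 1 / 2⌋₊ := by
    rw [Nat.one_le_floor_iff]
    have : (1 / 2 : ℝ) ≤ √(2 * (t : ℝ) - 7 / 4) := Real.le_sqrt_of_sq_le (by linarith)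
    linarith
  obtain ⟨n, hn⟩ := Nat.exists_eq_add_of_le' h0
  refine ⟨n, by rw [alphabetSize, hn], ?_⟩
  have h1 : ((n + 1 : ℕ) : ℝ) ≤ √(2 * (t : ℝ) - 7 / 4) + 1 / 2 := by
    rw [← hn]
    exact Nat.floor_le (by positivity)
  push_cast at h1
  have h2 : ((n : ℝ) + 1 / 2) ^ 2 ≤ 2 * (t : ℝ) - 7 / 4 := by
    rw [← Real.le_sqrt (by positivity) (by linarith)]
    linarith
  have hch : 2 * (n + 1).choose 2 = (n + 1) * n := by
    rw [Nat.choose_two_right, Nat.mul_div_cancel' (Nat.even_mul_pred_self (n + 1)).two_dvd]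
    rfl
  have hch' : (2 * (n + 1).choose 2 : ℝ) = (n + 1) * n := by exact_mod_cast hch
  have h3 : ((n + 1).choose 2 : ℝ) + 1 ≤ t := by nlinarith
  exact_mod_cast h3

section Plane

variable {F : Type*} [Field F]

theorem exists_dotProduct_eq_zero_of_det_eq_zero {u w : Fin 2 → F}
    (h : u 0 * w 1 - u 1 * w 0 = 0) : ∃ y ≠ 0, u ⬝ᵥ y = 0 ∧ w ⬝ᵥ y = 0 := by
  obtain ⟨y, hy, hM⟩ := Matrix.exists_mulVec_eq_zero_iff.mpr
    (show (Matrix.of ![u, w]).det = 0 by simpa [Matrix.det_fin_two] using h)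
  exact ⟨y, hy, congrFun hM 0, congrFun hM 1⟩

theorem exists_eq_smul_pointVector {v : Fin 2 → F} (hv : v ≠ 0) :
    ∃ (r : Option F) (a : F), a ≠ 0 ∧ v = a • pointVector r := by
  by_cases h : v 0 = 0
  · refine ⟨none, v 1, fun h1 => hv ?_, ?_⟩
    · ext i
      fin_cases i
      exacts [h, h1]
    · ext i
      fin_cases i <;> simp [pointVector, h]
  · refine ⟨some (v 1 / v 0), v 0, h, ?_⟩
    ext i
    fin_cases i
    · simp [pointVector]
    · simp [pointVector, mul_div_cancel₀ _ h]

end Plane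

/-! ### The cut bound and the chain network -/

namespace Network

variable {V E : Type*} {N : Network V E}

/-- The cut bound: whatever can be decoded at `r` has to cross each cut. -/
theorem Decodes.two_le_cut [Finite V] [Finite E] {F : Type*} [Field F] {f : E → Fin 2 → F}
    (hf : N.IsLinearCode f) {r : V} (hr : N.Decodes f r) {X : Set V} (hX : r ∉ X) :
    2 ≤ (N.edgesOut X).ncard + {i | N.source i ∉ X}.ncard := by
  classical
  have := Fintype.ofFinite E
  obtain ⟨rank, hrank⟩ := N.exists_rank
  set S : Set (Fin 2 → F) :=
    f '' N.edgesOut X ∪ (fun i => Pi.single i 1) '' {i | N.source i ∉ X} with hS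
  have hin : ∀ v ∉ X, N.inputs f v ⊆ Submodule.span F S := by
    intro v hv
    induction hn : rank v using Nat.strong_induction_on generalizing v with
    | _ n ih =>
      subst hn
      rintro c (⟨e, rfl, rfl⟩ | ⟨i, rfl, rfl⟩)
      · by_cases he : N.tail e ∈ X
        · exact Submodule.subset_span (.inl ⟨e, ⟨he, hv⟩, rfl⟩)
        · exact Submodule.span_le.mpr (ih _ (hrank e) _ he rfl) (hf e)
      · exact Submodule.subset_span (.inr ⟨i, hv, rfl⟩)
  -- A nonzero functional vanishing on `S` is the dot product with a nonzero source word that `r`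
  -- cannot tell from `0`.
  have htop : Submodule.span F S = ⊤ := by
    by_contra h
    obtain ⟨φ, hφ, hker⟩ := Submodule.exists_le_ker_of_lt_top _ (lt_top_iff_ne_top.mpr h)
    have hφc : ∀ c, φ c = c ⬝ᵥ fun i => φ (Pi.single i 1) := by
      intro c
      rw [dotProduct, LinearMap.pi_apply_eq_sum_univ φ c]
      refine Finset.sum_congr rfl fun i _ => ?_
      rw [smul_eq_mul]
      congr 2
      ext j
      simp [Pi.single_apply, eq_comm]
    have h0 := hr (fun i => φ (Pi.single i 1)) 0 fun c hc => by
      rw [← hφc, dotProduct_zero]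
      exact hker (hin r hX hc)
    refine hφ (LinearMap.ext fun c => ?_)
    rw [hφc, h0, dotProduct_zero, LinearMap.zero_apply]
  have hfin : S.Finite := Set.toFinite _
  have := hfin.fintype
  have h1 := finrank_span_le_card (R := F) S
  rw [htop, finrank_top, Module.finrank_fin_fun, ← Set.ncard_eq_toFinset_card'] at h1
  refine h1.trans ((Set.ncard_union_le _ _).trans ?_)
  exact add_le_add (Set.ncard_image_le (Set.toFinite _)) (Set.ncard_image_le (Set.toFinite _))

theorem acyclic_of_rank {tail head : E → V} (rank : V → ℕ)
    (h : ∀ e, rank (tail e) < rank (head e)) (v : V) :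
    ¬ Relation.TransGen (fun u w => ∃ e, tail e = u ∧ head e = w) v v := by
  have hlt : ∀ u w, Relation.TransGen (fun u w => ∃ e, tail e = u ∧ head e = w) u w →
      rank u < rank w := by
    intro u w huw
    induction huw with
    | single h' => obtain ⟨e, rfl, rfl⟩ := h'; exact h e
    | tail _ h' ih => obtain ⟨e, rfl, rfl⟩ := h'; exact ih.trans (h e)
  exact fun hv => lt_irrefl _ (hlt v v hv)

end Network

/-- The nodes of the chain network. -/
inductive ChainNode (n t : ℕ) : Type
  | source
  | joint (i : Fin n)
  | branch (i : Fin (n + 2))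
  | receiver (j : Fin t)

/-- The edges of the chain network. -/
inductive ChainEdge (n t : ℕ) : Type
  | main (i : Fin (n + 2))
  | first (i : Fin n)
  | previous (i : Fin n)
  | receive (j : Fin t) (left : Bool)

instance (n t : ℕ) : Finite (ChainNode n t) :=
  Finite.of_surjective
    (Sum.elim (fun _ : Unit => .source) (Sum.elim .joint (Sum.elim .branch .receiver)) :
      Unit ⊕ Fin n ⊕ Fin (n + 2) ⊕ Fin t → ChainNode n t)
    fun
    | .source => ⟨.inl (), rfl⟩
    | .joint i => ⟨.inr (.inl i), rfl⟩
    | .branch i => ⟨.inr (.inr (.inl i)), rfl⟩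
    | .receiver j => ⟨.inr (.inr (.inr j)), rfl⟩

instance (n t : ℕ) : Finite (ChainEdge n t) :=
  Finite.of_surjective
    (Sum.elim .main (Sum.elim .first (Sum.elim .previous fun z => .receive z.1 z.2)) :
      Fin (n + 2) ⊕ Fin n ⊕ Fin n ⊕ Fin t × Bool → ChainEdge n t)
    fun
    | .main i => ⟨.inl i, rfl⟩
    | .first i => ⟨.inr (.inl i), rfl⟩
    | .previous i => ⟨.inr (.inr (.inl i)), rfl⟩
    | .receive j l => ⟨.inr (.inr (.inr (j, l))), rfl⟩

namespace ChainNode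

/-- `joint i` lies between the branches `i + 1` and `i + 2`, of ranks `2i + 3` and `2i + 5`;
receivers lie above the last branch, of rank `2n + 3`. -/
def rank {n t : ℕ} : ChainNode n t → ℕ
  | source => 0
  | joint i => 2 * i + 4
  | branch i => 2 * i + 1
  | receiver _ => 2 * n + 4

end ChainNode

namespace ChainEdge

variable {n t : ℕ}

def tail (a b : Fin t → Fin (n + 2)) : ChainEdge n t → ChainNode n t
  | main i => Fin.cases .source (Fin.cases .source .joint) i
  | first _ => .branch 0
  | previous i => .branch i.castSucc.succ
  | receive j l => .branch (if l then a j else b j)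

def head : ChainEdge n t → ChainNode n t
  | main i => .branch i
  | first i => .joint i
  | previous i => .joint i
  | receive j _ => .receiver j

theorem rank_tail_lt (a b : Fin t → Fin (n + 2)) (e : ChainEdge n t) :
    (e.tail a b).rank < e.head.rank := by
  rcases e with i | i | i | ⟨j, l⟩
  · refine Fin.cases ?_ (fun i => Fin.cases ?_ (fun i => ?_) i) i
    · exact Nat.succ_pos _
    · exact Nat.succ_pos _
    · simp only [tail, head, ChainNode.rank, Fin.cases_succ, Fin.val_succ]
      omega
  · simp [tail, head, ChainNode.rank]
  · simp only [tail, head, ChainNode.rank, Fin.val_succ, Fin.val_castSucc]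
    omega
  · simp only [tail, head, ChainNode.rank]
    omega

end ChainEdge

/-- The network in which branch `i + 2` carries a combination of the branches `0` and `i + 1`, and
receiver `j` is fed by the branches `a j` and `b j`. -/
def chainNetwork {n t : ℕ} (a b : Fin t → Fin (n + 2)) :
    Network (ChainNode n t) (ChainEdge n t) where
  tail := ChainEdge.tail a b
  head := ChainEdge.head
  source _ := .source
  acyclic := Network.acyclic_of_rank ChainNode.rank (ChainEdge.rank_tail_lt a b)

namespace chainNetwork

variable {n t : ℕ} {a b : Fin t → Fin (n + 2)} {F : Type*} [Field F]

theorem inputs_branch (f : ChainEdge n t → Fin 2 → F) (i : Fin (n + 2)) :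
    (chainNetwork a b).inputs f (.branch i) = {f (.main i)} := by
  ext c
  constructor
  · rintro (⟨e, he, rfl⟩ | ⟨_, h, -⟩)
    · cases e <;> cases he
      rfl
    · cases h
  · rintro rfl
    exact .inl ⟨.main i, rfl, rfl⟩

theorem inputs_joint (f : ChainEdge n t → Fin 2 → F) (i : Fin n) :
    (chainNetwork a b).inputs f (.joint i) = {f (.first i), f (.previous i)} := by
  ext c
  constructor
  · rintro (⟨e, he, rfl⟩ | ⟨_, h, -⟩)
    · cases e <;> cases he
      exacts [.inl rfl, .inr rfl]
    · cases h
  · rintro (rfl | rfl)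
    exacts [.inl ⟨.first i, rfl, rfl⟩, .inl ⟨.previous i, rfl, rfl⟩]

theorem inputs_receiver (f : ChainEdge n t → Fin 2 → F) (j : Fin t) :
    (chainNetwork a b).inputs f (.receiver j) = {f (.receive j true), f (.receive j false)} := by
  ext c
  constructor
  · rintro (⟨e, he, rfl⟩ | ⟨_, h, -⟩)
    · cases e with
      | receive j' l =>
        cases he
        cases l
        exacts [.inr rfl, .inl rfl]
      | _ => cases he
    · cases h
  · rintro (rfl | rfl)
    exacts [.inl ⟨.receive j true, rfl, rfl⟩, .inl ⟨.receive j false, rfl, rfl⟩]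

/-- The chain network has a linear multicast code over the rationals. -/
theorem exists_code (hab : ∀ j, a j ≠ b j) : ∃ f : ChainEdge n t → Fin 2 → ℚ,
    (chainNetwork a b).IsLinearCode f ∧ ∀ j, (chainNetwork a b).Decodes f (.receiver j) := by
  -- The points `[1 0]`, `[0 1]`, `[1 1]`, `[2 1]`, ... are distinct over `ℚ`, whatever `n` is.
  let c : Fin (n + 2) → Fin 2 → ℚ := Fin.cases ![1, 0] fun i => ![(i : ℕ), 1]
  have hc : ∀ x y, x ≠ y → c x 0 * c y 1 - c x 1 * c y 0 ≠ 0 := by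
    intro x y
    refine Fin.cases (Fin.cases ?_ (fun y => ?_) y) (fun x => Fin.cases ?_ (fun y => ?_) y) x
    · exact fun h => absurd rfl h
    · simp [c]
    · simp [c]
    · intro h
      simp only [c, Fin.cases_succ, Matrix.cons_val_zero, Matrix.cons_val_one, mul_one, one_mul,
        sub_ne_zero]
      intro h'
      exact h (congrArg Fin.succ (Fin.ext (by exact_mod_cast h')))
  let f : ChainEdge n t → Fin 2 → ℚ
    | .main i => c i
    | .first _ => c 0
    | .previous i => c i.castSucc.succ
    | .receive j l => c (if l then a j else b j)
  have hsource : ∀ v, v ∈ Submodule.span ℚ ((chainNetwork a b).inputs f .source) := by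
    intro v
    refine Submodule.span_mono ?_ (mem_span_pair_of_det_ne_zero
      (u := Pi.single 0 1) (w := Pi.single 1 1) (by simp) v)
    rintro c (rfl | rfl)
    exacts [.inr ⟨0, rfl, rfl⟩, .inr ⟨1, rfl, rfl⟩]
  refine ⟨f, fun e => ?_, fun j y y' h => ?_⟩
  · rcases e with i | i | i | ⟨j, l⟩
    · refine Fin.cases (hsource _) (fun i => Fin.cases (hsource _) (fun i => ?_) i) i
      change f (.main i.succ.succ) ∈ Submodule.span ℚ ((chainNetwork a b).inputs f (.joint i))
      rw [inputs_joint]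
      exact mem_span_pair_of_det_ne_zero (hc _ _ (Fin.succ_ne_zero _).symm) _
    all_goals
      refine Submodule.subset_span ?_
      simp only [chainNetwork, ChainEdge.tail]
      erw [inputs_branch]
      rfl
  · rw [inputs_receiver] at h
    exact eq_of_dotProduct_eq_of_det_ne_zero (hc _ _ (hab j)) (h _ (.inl rfl)) (h _ (.inr rfl))

theorem edgesOut_compl_receiver (j : Fin t) :
    (chainNetwork a b).edgesOut {.receiver j}ᶜ ⊆ {.receive j true, .receive j false} := by
  rintro e ⟨-, he⟩
  have he : e.head = .receiver j := not_not.mp he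
  cases e with
  | receive j' l =>
    cases he
    cases l
    exacts [.inr rfl, .inl rfl]
  | _ => cases he

theorem ncard_edgesOut_compl_receiver_le (j : Fin t) :
    ((chainNetwork a b).edgesOut {.receiver j}ᶜ).ncard ≤ 2 :=
  (Set.ncard_le_ncard (edgesOut_compl_receiver j) (Set.toFinite _)).trans <|
    (Set.ncard_insert_le _ _).trans (by rw [Set.ncard_singleton])

theorem ncard_source_eq_zero {X : Set (ChainNode n t)} (hX : .source ∈ X) :
    {i | (chainNetwork a b).source i ∉ X}.ncard = 0 := by
  have : {i | (chainNetwork a b).source i ∉ X} = ∅ :=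
    Set.eq_empty_of_forall_notMem fun i hi => hi hX
  rw [this, Set.ncard_empty]

/-- The two edges into the receiver form a cut. The lower bound is the cut bound applied to the
rational code, so no disjoint paths are constructed. -/
theorem minCut_receiver (hab : ∀ j, a j ≠ b j) (j : Fin t) :
    (chainNetwork a b).minCut (.receiver j) = 2 := by
  obtain ⟨f, hf, hdec⟩ := exists_code hab
  have hmem : ((chainNetwork a b).edgesOut {.receiver j}ᶜ).ncard +
      {i | (chainNetwork a b).source i ∉ ({.receiver j}ᶜ : Set _)}.ncard ∈ {c | ∃ X : Set _,
        .receiver j ∉ X ∧ c = ((chainNetwork a b).edgesOut X).ncard +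
          {i | (chainNetwork a b).source i ∉ X}.ncard} := ⟨_, by simp, rfl⟩
  refine le_antisymm ((Nat.sInf_le hmem).trans ?_) (le_csInf ⟨_, hmem⟩ ?_)
  · rw [ncard_source_eq_zero (by simp)]
    exact ncard_edgesOut_compl_receiver_le j
  · rintro _ ⟨X, hX, rfl⟩
    exact (hdec j).two_le_cut hf hX

theorem minCutFrom_receiver (hab : ∀ j, a j ≠ b j) (j : Fin t) :
    (chainNetwork a b).minCutFrom .source (.receiver j) = 2 := by
  obtain ⟨f, hf, hdec⟩ := exists_code hab
  have hmem : ((chainNetwork a b).edgesOut {.receiver j}ᶜ).ncard ∈ {c | ∃ X : Set _,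
      .source ∈ X ∧ .receiver j ∉ X ∧ c = ((chainNetwork a b).edgesOut X).ncard} :=
    ⟨_, by simp, by simp, rfl⟩
  refine le_antisymm ((Nat.sInf_le hmem).trans (ncard_edgesOut_compl_receiver_le j))
    (le_csInf ⟨_, hmem⟩ ?_)
  rintro _ ⟨X, hs, hX, rfl⟩
  have := (hdec j).two_le_cut hf hX
  rwa [ncard_source_eq_zero hs] at this

theorem injective_ends (hab : ∀ j, a j ≠ b j) :
    Function.Injective fun e => ((chainNetwork a b).tail e, (chainNetwork a b).head e) := by
  intro e e' h
  obtain ⟨ht, hh⟩ := Prod.mk.inj h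
  simp only [chainNetwork] at ht hh
  rcases e with i | i | i | ⟨j, l⟩ <;> rcases e' with i' | i' | i' | ⟨j', l'⟩ <;> cases hh
  · rfl
  · rfl
  · exact absurd (ChainNode.branch.inj ht) (Fin.succ_ne_zero _).symm
  · exact absurd (ChainNode.branch.inj ht) (Fin.succ_ne_zero _)
  · rfl
  · have ht := ChainNode.branch.inj ht
    have := hab j
    cases l <;> cases l' <;> simp_all [eq_comm]

theorem det_receiver_ne_zero {f : ChainEdge n t → Fin 2 → F}
    (hf : (chainNetwork a b).IsLinearCode f) {j : Fin t}
    (hj : (chainNetwork a b).Decodes f (.receiver j)) {x y : Fin (n + 2)}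
    (hxy : s(a j, b j) = s(x, y)) :
    f (.main x) 0 * f (.main y) 1 - f (.main x) 1 * f (.main y) 0 ≠ 0 := by
  intro h
  obtain ⟨v, hv, hxv, hyv⟩ := exists_dotProduct_eq_zero_of_det_eq_zero h
  have hz : ∀ z ∈ s(x, y), f (.main z) ⬝ᵥ v = 0 := by
    intro z hz
    rcases Sym2.mem_iff.mp hz with rfl | rfl
    exacts [hxv, hyv]
  have hl : ∀ l, f (.receive j l) ⬝ᵥ v = 0 := by
    intro l
    have h1 : f (.receive j l) ∈ Submodule.span F
      ((chainNetwork a b).inputs f (.branch (if l then a j else b j))) := hf (.receive j l)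
    rw [inputs_branch, Submodule.mem_span_singleton] at h1
    obtain ⟨α, hα⟩ := h1
    rw [← hα, smul_dotProduct, hz, smul_zero]
    rw [← hxy]
    cases l <;> simp
  refine hv (hj v 0 fun c hc => ?_)
  rw [inputs_receiver] at hc
  rcases hc with rfl | rfl <;> rw [hl, dotProduct_zero]

/-- If the receivers see all pairs of branches but those of branch `0` and a branch other than the
last one, then a multicast code has pairwise independent branches. -/
theorem det_ne_zero {f : ChainEdge n t → Fin 2 → F} (hf : (chainNetwork a b).IsLinearCode f)
    (hdec : ∀ j, (chainNetwork a b).Decodes f (.receiver j))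
    (hlast : ∃ j, s(a j, b j) = s(0, Fin.last (n + 1)))
    (hpairs : ∀ x y : Fin (n + 1), x ≠ y → ∃ j, s(a j, b j) = s(x.succ, y.succ))
    (x y : Fin (n + 2)) (hxy : x ≠ y) :
    f (.main x) 0 * f (.main y) 1 - f (.main x) 1 * f (.main y) 0 ≠ 0 := by
  have hzero : ∀ y : Fin (n + 1),
      f (.main 0) 0 * f (.main y.succ) 1 - f (.main 0) 1 * f (.main y.succ) 0 ≠ 0 := by
    intro y
    -- Branch `i + 2` lies in the span of branches `0` and `i + 1`, so dependence of branches `0`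
    -- and `i + 1` passes on to `0` and `i + 2`. Independence thus descends from the last branch.
    induction y using Fin.reverseInduction with
    | last =>
      obtain ⟨j, hj⟩ := hlast
      exact det_receiver_ne_zero hf (hdec j) hj
    | cast i ih =>
      intro h
      have h1 : f (.main i.succ.succ) ∈ Submodule.span F
        ((chainNetwork a b).inputs f (.joint i)) := hf (.main i.succ.succ)
      have h2 : f (.first i) ∈ Submodule.span F
        ((chainNetwork a b).inputs f (.branch 0)) := hf (.first i)
      have h3 : f (.previous i) ∈ Submodule.span F
        ((chainNetwork a b).inputs f (.branch i.castSucc.succ)) := hf (.previous i)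
      rw [inputs_joint, Submodule.mem_span_pair] at h1
      rw [inputs_branch, Submodule.mem_span_singleton] at h2 h3
      obtain ⟨α, β, h1⟩ := h1
      obtain ⟨γ, h2⟩ := h2
      obtain ⟨δ, h3⟩ := h3
      apply ih
      rw [← h1, ← h2, ← h3]
      simp only [Pi.add_apply, Pi.smul_apply, smul_eq_mul]
      linear_combination β * δ * h
  by_cases hx : x = 0
  · subst hx
    obtain ⟨y, rfl⟩ := Fin.exists_succ_eq.mpr hxy.symm
    exact hzero y
  obtain ⟨x, rfl⟩ := Fin.exists_succ_eq.mpr hx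
  by_cases hy : y = 0
  · subst hy
    exact fun h => hzero x (by linear_combination -h)
  obtain ⟨y, rfl⟩ := Fin.exists_succ_eq.mpr hy
  obtain ⟨j, hj⟩ := hpairs x y fun h => hxy (congrArg _ h)
  exact det_receiver_ne_zero hf (hdec j) hj

end chainNetwork

theorem exists_receiver_pairs {n t : ℕ} (h : (n + 1).choose 2 + 1 ≤ t) :
    ∃ a b : Fin t → Fin (n + 2), (∀ j, a j ≠ b j) ∧
      (∃ j, s(a j, b j) = s(0, Fin.last (n + 1))) ∧
      ∀ x y : Fin (n + 1), x ≠ y → ∃ j, s(a j, b j) = s(x.succ, y.succ) := by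
  classical
  have hcard : Fintype.card (Option {z : Sym2 (Fin (n + 1)) // ¬ z.IsDiag}) ≤
      Fintype.card (Fin t) := by
    rw [Fintype.card_option, Sym2.card_subtype_not_diag, Fintype.card_fin, Fintype.card_fin]
    exact h
  -- One receiver is reserved for each pair of nonzero branches, and `none` stands for the pair of
  -- branch `0` and the last one. Any surplus receivers get an arbitrary one of these pairs through
  -- `invFun`.
  obtain ⟨g⟩ := Function.Embedding.nonempty_of_card_le hcard
  have hrep : ∀ z : Option {z : Sym2 (Fin (n + 1)) // ¬ z.IsDiag}, ∃ x y : Fin (n + 2), x ≠ y ∧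
      s(x, y) = z.elim s(0, Fin.last (n + 1)) fun z => z.1.map Fin.succ := by
    rintro (_ | ⟨z, hz⟩)
    · exact ⟨0, Fin.last (n + 1), (Fin.last_pos).ne, rfl⟩
    · induction z with
      | _ x y =>
        exact ⟨x.succ, y.succ, fun h => hz (Sym2.mk_isDiag_iff.mpr (Fin.succ_injective _ h)), rfl⟩
  choose x y hxy hz using hrep
  have hinv := Function.leftInverse_invFun g.injective
  refine ⟨fun j => x (Function.invFun g j), fun j => y (Function.invFun g j), fun j => hxy _,
    ⟨g none, ?_⟩, fun u v huv => ⟨g (some ⟨s(u, v), by simpa using huv⟩), ?_⟩⟩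
  · simp only [hinv none]
    exact hz none
  · simp only [hinv (some _)]
    exact hz (some _)

/-- Pairwise independent coding vectors of a secure code, together with the point that the code
misses, are distinct points of the projective line. -/
theorem IsSecureCode.card_le {V E F : Type*} [Field F] [Fintype F] {N : Network V E} {t m : ℕ}
    {R : Fin t → V} {enc : F → PMF (Fin 2 → F)} {f : E → Fin 2 → F} (h : IsSecureCode N R enc f)
    (g : Fin (m + 2) → E)
    (hg : ∀ x y, x ≠ y → f (g x) 0 * f (g y) 1 - f (g x) 1 * f (g y) 0 ≠ 0) :
    m + 2 ≤ Fintype.card F := by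
  classical
  obtain ⟨r₀, hr₀⟩ := h.exists_point
  have hne : ∀ x, f (g x) ≠ 0 := by
    intro x hx
    obtain ⟨y, hy⟩ := exists_ne x
    exact hg x y hy.symm (by simp [hx])
  choose r α hα hr using fun x => exists_eq_smul_pointVector (hne x)
  have hinj : Function.Injective r := by
    intro x y hxy
    by_contra hne
    refine hg x y hne ?_
    rw [hr x, hr y, hxy]
    simp only [Pi.smul_apply, smul_eq_mul]
    ring
  have hmiss : r₀ ∉ Finset.univ.image r := by
    intro h
    obtain ⟨x, -, rfl⟩ := Finset.mem_image.mp h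
    exact hr₀ _ _ (hα x) (hr x)
  -- The `m + 2` points of the edges and the missed point are among the `q + 1` points of the
  -- projective line.
  have hle := Finset.card_le_univ (insert r₀ (Finset.univ.image r))
  rw [Finset.card_insert_of_notMem hmiss, Finset.card_image_of_injective _ hinj,
    Finset.card_univ, Fintype.card_fin, Fintype.card_option] at hle
  exact Nat.le_of_succ_le_succ hle

end WiretapNetwork

theorem theorem3 (t : ℕ) (ht : 1 ≤ t) :
    -- Sufficiency, with the coset code of `H = [1 1]` and coding vectors avoiding the point `[1 1]`.
    (∀ (V E F : Type*) [Finite V] [Finite E] [Field F] [Fintype F]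
        (N : WiretapNetwork.Network V E) (R : Fin t → V), N.IsConfiguration R →
        WiretapNetwork.alphabetSize t ≤ Fintype.card F →
        ∃ f : E → Fin 2 → F,
          WiretapNetwork.IsSecureCode N R
            (WiretapNetwork.cosetEncoder ![1, 1] WiretapNetwork.oneOne_ne_zero) f ∧
          ∀ e, f e ≠ 0 → f e ∉ Submodule.span F {![1, 1]}) ∧
    -- Necessity: some network without parallel edges, with one source node holding both symbols and
    -- minimum cut two from it to each receiver, has no secure code over any smaller field.
    (∃ (V E : Type) (_ : Finite V) (_ : Finite E) (N : WiretapNetwork.Network V E) (R : Fin t → V)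
        (s : V), N.IsConfiguration R ∧ (∀ i, N.source i = s) ∧
        (∀ j, N.minCutFrom s (R j) = 2) ∧
        (Function.Injective fun e => (N.tail e, N.head e)) ∧
        ∀ (F : Type*) [Field F] [Fintype F] (enc : F → PMF (Fin 2 → F)) (f : E → Fin 2 → F),
          WiretapNetwork.IsSecureCode N R enc f →
          WiretapNetwork.alphabetSize t ≤ Fintype.card F) := by
  refine ⟨fun V E F _ _ _ _ N R hR hq => ?_, ?_⟩
  · obtain ⟨f, hf, hdec, hne⟩ :=
      hR.exists_code (WiretapNetwork.le_choose_of_alphabetSize_le hq)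
    refine ⟨f, ⟨hf, hdec, WiretapNetwork.condEntropy_cosetEncoder_symbols,
      fun e => WiretapNetwork.condEntropy_cosetEncoder_packet (hne e)⟩, fun e he hspan => ?_⟩
    obtain ⟨a, ha⟩ := Submodule.mem_span_singleton.mp hspan
    refine (hne e).resolve_left he ?_
    simp [← ha]
  · obtain ⟨n, hn, hnt⟩ := WiretapNetwork.exists_alphabetSize_eq ht
    obtain ⟨a, b, hab, hlast, hpairs⟩ := WiretapNetwork.exists_receiver_pairs hnt
    refine ⟨WiretapNetwork.ChainNode n t, WiretapNetwork.ChainEdge n t, inferInstance,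
      inferInstance, WiretapNetwork.chainNetwork a b, .receiver, .source,
      ⟨fun _ _ h => WiretapNetwork.ChainNode.receiver.inj h,
        WiretapNetwork.chainNetwork.minCut_receiver hab⟩, fun _ => rfl,
      WiretapNetwork.chainNetwork.minCutFrom_receiver hab,
      WiretapNetwork.chainNetwork.injective_ends hab, fun F _ _ enc f h => ?_⟩
    rw [hn]
    exact h.card_le .main
      (WiretapNetwork.chainNetwork.det_ne_zero h.linear h.decodes hlast hpairs)
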